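/- Let $Q\in\mathbb{Z}[y_1,y_2,y_3]$ be a quadratic form, let $M_Q=\left(\frac{\partial^2 Q}{\partial y_i\partial y_j}\right)_{i,j}$ be its associated integral symmetric matrix, let $\Delta_Q=\det M_Q$ be its discriminant, and let $D_Q$ be the greatest common divisor of the $2\times 2$ minors of $M_Q$. Suppose that $Q$ is non-singular ($\Delta_Q\neq 0$) and isotropic (it has a non-trivial zero in $\mathbb{Q}^3$). Then there is a quadratic Dirichlet character $\chi_Q$ (one taking values in $\{0,\pm1\}$; the principal character is allowed) such that $$\#\{\mathbf{y}\bmod p: Q(\mathbf{y})\equiv 0 \bmod p,\ p\nmid \mathbf{y}\}=p(p-1)(1+\chi_Q(p))+p-1$$ for every prime $p$ with $p\mid\Delta_Q$ and $p\nmid 2D_Q$. Moreover, for any such character $\chi_Q$ and any real numbers $w,B_1,B_2,B_3>0$, $$\#\left\{\mathbf{y}\in\mathbb{Z}^3:\ \gcd(y_1,y_2,y_3)=1,\ Q(\mathbf{y})=0,\ |y_i|\le B_i \text{ for } i=1,2,3\right\}\ll C(Q,w)\left(1+\frac{(B_1B_2B_3)^{1/3}D_Q^{1/2}}{|\Delta_Q|^{1/3}}\right),$$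 where the implied constant is absolute (in particular independent of $Q,\chi_Q,w,B_1,B_2,B_3$) and $$C(Q,w)=\prod_{\substack{p^\xi\|\Delta_Q\\ p\mid 2D_Q\text{ or }p\le w}}\tau(p^\xi)\ \prod_{\substack{p^\xi\|\Delta_Q\\ p>w,\ p\nmid 2D_Q}}\left(\sum_{k=0}^{\xi}\chi_Q(p)^k\right).$$ Here $\tau$ is the divisor function and the products run over the primes $p\mid\Delta_Q$, with $\xi\geq 1$ the exact exponent of $p$ in $\Delta_Q$. -/

import Mathlib

namespace TernaryForm

open MvPolynomial

/-- The matrix associated to a ternary quadratic form `Q ∈ ℤ[y₁,y₂,y₃]`: the integral symmetric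
matrix of second partial derivatives, so that `2 Q(y) = yᵀ M y`. (For a quadratic form the second
derivatives are constant polynomials.) -/
noncomputable def assocMatrix (Q : MvPolynomial (Fin 3) ℤ) : Matrix (Fin 3) (Fin 3) ℤ :=
  Matrix.of fun i j => constantCoeff (pderiv i (pderiv j Q))

/-- The discriminant `Δ_Q`, the determinant of the associated matrix. -/
noncomputable def discr (Q : MvPolynomial (Fin 3) ℤ) : ℤ := (assocMatrix Q).det

/-- `D_Q`, the (non-negative) greatest common divisor of the nine `2 × 2` minors of the associated
matrix; the minor indexed by `(i, j)` is obtained by deleting row `i` and column `j`. -/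
noncomputable def minorGcd (Q : MvPolynomial (Fin 3) ℤ) : ℕ :=
  Finset.univ.gcd fun ij : Fin 3 × Fin 3 =>
    ((assocMatrix Q).submatrix ij.1.succAbove ij.2.succAbove).det.natAbs

/-- `Q` is isotropic: it has a non-trivial rational zero. -/
def IsIsotropic (Q : MvPolynomial (Fin 3) ℤ) : Prop :=
  ∃ y : Fin 3 → ℚ, y ≠ 0 ∧ aeval y Q = 0

/-- The number of `y mod p` with `p ∤ y` and `Q(y) ≡ 0 mod p`. -/
noncomputable def zerosMod (Q : MvPolynomial (Fin 3) ℤ) (p : ℕ) : ℕ :=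
  {y : Fin 3 → ZMod p | y ≠ 0 ∧ aeval y Q = 0}.ncard

/-- `χ` is a quadratic Dirichlet character `χ_Q` associated to `Q`: for every prime `p` with
`p ∣ Δ_Q` and `p ∤ 2 D_Q`, the number of non-zero solutions of `Q ≡ 0` modulo `p` is
`p (p - 1) (1 + χ(p)) + p - 1`. -/
def IsAssocCharacter (Q : MvPolynomial (Fin 3) ℤ) {N : ℕ} (χ : DirichletCharacter ℤ N) : Prop :=
  MulChar.IsQuadratic χ ∧
    ∀ p : ℕ, p.Prime → (p : ℤ) ∣ discr Q → ¬ p ∣ 2 * minorGcd Q →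
      (zerosMod Q p : ℤ) = p * (p - 1) * (1 + χ (p : ZMod N)) + p - 1

open Classical in
/-- The factor `C(Q, w)`, where `p ^ ξ` exactly divides `Δ_Q` and `τ` is the divisor function:
the product of `τ(p ^ ξ)` over the primes `p ∣ Δ_Q` with `p ∣ 2 D_Q` or `p ≤ w`, times the product
of `∑_{0 ≤ k ≤ ξ} χ(p) ^ k` over the primes `p ∣ Δ_Q` with `p > w` and `p ∤ 2 D_Q`. -/
noncomputable def constC (Q : MvPolynomial (Fin 3) ℤ) {N : ℕ} (χ : DirichletCharacter ℤ N)
    (w : ℝ) : ℤ :=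
  (∏ p ∈ (discr Q).natAbs.primeFactors with p ∣ 2 * minorGcd Q ∨ (p : ℝ) ≤ w,
      (((p ^ (discr Q).natAbs.factorization p).divisors.card : ℕ) : ℤ)) *
    ∏ p ∈ (discr Q).natAbs.primeFactors with ¬ p ∣ 2 * minorGcd Q ∧ w < (p : ℝ),
      ∑ k ∈ Finset.range ((discr Q).natAbs.factorization p + 1), χ (p : ZMod N) ^ k

/-- The primitive integer zeros `y` of `Q` with `|y_i| ≤ B_i` for `i = 1, 2, 3`. -/
def primitiveZeros (Q : MvPolynomial (Fin 3) ℤ) (B : Fin 3 → ℝ) : Set (Fin 3 → ℤ) :=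
  {y | Finset.univ.gcd y = 1 ∧ eval y Q = 0 ∧ ∀ i, |(y i : ℝ)| ≤ B i}

end TernaryForm

/-! The count splits into an arithmetic and a geometric half.

Arithmetic: let `b` be the bilinear form of the associated matrix. The primitive zeros are sorted
into at most `8 * constC Q χ w` classes such that `discr Q` divides `2 ^ 14 * minorGcd Q * b(s, t)`
whenever `s` and `t` share a class (`exists_global_classes`). This is local. Over `ℤ_p` the form
becomes `A x² + B y² + C z²` on a sublattice of index 8, with `A` and `B` dividing `C`
(`exists_orthogonal_basis`). Modulo `C` a zero satisfies `A x² ≡ -B y²`, so it is described by the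
valuation of `y` and a choice of square root, plus one class for points near the singular point
(`exists_padic_classes`). If `p ∤ 2 D_Q` then `A`, `B` are units. The two square roots exist only if
`-AB` is a square modulo `p`, which is what the count of zeros modulo `p` detects; hence `ξ + 1`
classes when `χ(p) = 1`, and when `χ(p) = -1` one class for even `ξ` and none for odd `ξ`.

For three zeros the Gram matrix has zero diagonal, so `det² Δ = 2 b(s,t) b(t,u) b(s,u)`. Within a
class this forces `|det| ≥ |Δ| / (2 ^ 21 D^(3/2))` unless `det = 0` (`discr_sq_le`).

Geometry: a smooth conic is parametrised quadratically, so its points, read in a suitable affine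
chart of the box, are in convex position in `[-1, 1]²`, and the determinant bound says that every
triangle has area at least `r³ / 2`. Such a configuration has `O(1 + 1/r)` points
(`card_mul_le_of_orient`, `card_conic_le`). Multiplying by the number of classes gives the bound.

The character itself comes from prescribing Legendre symbols by Dirichlet's theorem and quadratic
reciprocity (`exists_quadratic_character`). -/

namespace TernaryForm

/-! ### Plane geometry: points in convex position spanning large triangles. -/

/-- Twice the signed area of the triangle with vertices `(x a, y a)`, `(x b, y b)`, `(x c, y c)`. -/
def orient {ι : Type*} (x y : ι → ℝ) (a b c : ι) : ℝ :=
  (x b - x a) * (y c - y a) - (x c - x a) * (y b - y a)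

/-- AM–GM. It turns a lower bound for an area, a product of three factors, into a linear inequality
that telescopes. -/
lemma three_mul_le_add_of_cube_le {a b c r : ℝ} (ha : 0 ≤ a) (hb : 0 ≤ b) (hc : 0 ≤ c)
    (h : r ^ 3 ≤ a * b * c) : 3 * r ≤ a + b + c := by
  by_contra! hlt
  have h0 : 0 ≤ a + b + c := by positivity
  have h1 : (a + b + c) ^ 3 < (3 * r) ^ 3 := pow_lt_pow_left₀ hlt h0 (by norm_num)
  have h2 : 27 * (a * b * c) ≤ (a + b + c) ^ 3 := by
    nlinarith [mul_nonneg ha (sq_nonneg (b - c)), mul_nonneg hb (sq_nonneg (a - c)),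
      mul_nonneg hc (sq_nonneg (a - b)), mul_nonneg h0 (sq_nonneg (b - c)),
      mul_nonneg h0 (sq_nonneg (a - c)), mul_nonneg h0 (sq_nonneg (a - b))]
  nlinarith

/-- A monotone convex polygonal line in `[-1, 1]²` whose consecutive triangles have area bounded
below has few vertices. -/
lemma card_monotone_chain {x y : ℕ → ℝ} {n : ℕ} {r σ : ℝ} (hr : 0 < r) (hσ : |σ| = 1)
    (hx : ∀ i < n, x i ≤ x (i + 1)) (hy : ∀ i < n, y i ≤ y (i + 1))
    (hx1 : ∀ i ≤ n, |x i| ≤ 1) (hy1 : ∀ i ≤ n, |y i| ≤ 1)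
    (ho : ∀ i, i + 2 ≤ n → r ^ 3 ≤ σ * orient x y i (i + 1) (i + 2)) :
    ((n : ℝ) + 1) * r ≤ 2 * r + 3 := by
  rcases n with _ | m
  · norm_num; linarith
  -- `l` is the `ℓ¹` length of an edge and `v` its slope, normalised to lie in `[0, 1]`; consecutive
  -- edges span `l i * l (i + 1) * (v (i + 1) - v i)`. An edge of length zero gets `v i = 0`, and `v
  -- i * l i` is still right.
  set l : ℕ → ℝ := fun i => (x (i + 1) - x i) + (y (i + 1) - y i) with hl
  set v : ℕ → ℝ := fun i => (y (i + 1) - y i) / l i with hv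
  have hl0 : ∀ i < m + 1, 0 ≤ l i := fun i hi => by
    simp only [hl]; linarith [hx i hi, hy i hi]
  have hv0 : ∀ i < m + 1, 0 ≤ v i := fun i hi =>
    div_nonneg (by linarith [hy i hi]) (hl0 i hi)
  have hv1 : ∀ i < m + 1, v i ≤ 1 := fun i hi =>
    div_le_one_of_le₀ (by simp only [hl]; linarith [hx i hi]) (hl0 i hi)
  have hvl : ∀ i < m + 1, v i * l i = y (i + 1) - y i := fun i hi => by
    rcases (hl0 i hi).eq_or_lt with h | h
    · rw [← h]
      simp only [hl] at h
      linarith [hx i hi, hy i hi]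
    · exact div_mul_cancel₀ _ h.ne'
  have key : ∀ i ∈ Finset.range m, 3 * r ≤ l i + l (i + 1) + (σ * v (i + 1) - σ * v i) := by
    intro i hi
    have hi : i < m := Finset.mem_range.1 hi
    have h1 := ho i (by omega)
    have h2 : orient x y i (i + 1) (i + 2) = l i * l (i + 1) * (v (i + 1) - v i) := by
      have e1 := hvl i (by omega)
      have e2 := hvl (i + 1) (by omega)
      have e : l i * l (i + 1) * (v (i + 1) - v i)
        = l i * (v (i + 1) * l (i + 1)) - l (i + 1) * (v i * l i) := by ring
      rw [e, e1, e2]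
      simp only [orient, hl]
      ring
    have h3 := hl0 i (by omega)
    have h4 := hl0 (i + 1) (by omega)
    have h5 : r ^ 3 ≤ l i * l (i + 1) * (σ * v (i + 1) - σ * v i) := by
      rw [h2] at h1; linarith
    refine three_mul_le_add_of_cube_le h3 h4 ?_ h5
    by_contra! hneg
    have := mul_nonneg h3 h4
    have : 0 < r ^ 3 := by positivity
    nlinarith
  -- Each sum of lengths is at most 4 and the slopes vary by at most 1 in total, so `3 m r ≤ 9`,
  -- where `m + 2` is the number of points.
  have hsum := Finset.sum_le_sum key
  rw [Finset.sum_add_distrib, Finset.sum_add_distrib,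
    Finset.sum_range_sub (fun i => σ * v i)] at hsum
  simp only [Finset.sum_const, Finset.card_range, nsmul_eq_mul] at hsum
  have s1 : ∑ i ∈ Finset.range m, l i = (x m - x 0) + (y m - y 0) := by
    simp only [hl, Finset.sum_add_distrib, Finset.sum_range_sub]
  have s2 : ∑ i ∈ Finset.range m, l (i + 1) = (x (m + 1) - x 1) + (y (m + 1) - y 1) := by
    simp only [hl, Finset.sum_add_distrib]
    rw [Finset.sum_range_sub (fun i => x (i + 1)), Finset.sum_range_sub (fun i => y (i + 1))]
  have s3 : σ * v m - σ * v 0 ≤ 1 := by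
    have := hv0 m (by omega)
    have := hv0 0 (by omega)
    have := hv1 m (by omega)
    have := hv1 0 (by omega)
    rcases eq_or_eq_neg_of_abs_eq hσ with h | h <;> rw [h] <;> linarith
  rw [s1, s2] at hsum
  have b : ∀ i ≤ m + 1, (-1 ≤ x i ∧ x i ≤ 1) ∧ (-1 ≤ y i ∧ y i ≤ 1) := fun i hi =>
    ⟨abs_le.1 (hx1 i hi), abs_le.1 (hy1 i hi)⟩
  have b0 := b 0 (by omega)
  have b1 := b 1 (by omega)
  have b2 := b m (by omega)
  have b3 := b (m + 1) (by omega)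
  push_cast
  linarith [b0.1.1, b0.1.2, b0.2.1, b0.2.2, b1.1.1, b1.1.2, b1.2.1, b1.2.2, b2.1.1, b2.1.2,
    b2.2.1, b2.2.2, b3.1.1, b3.1.2, b3.2.1, b3.2.2]

/-- Reflecting the axes by `ε` and `η` makes the chain increasing and multiplies every orientation
by `ε * η`, which is the `σ` of `card_monotone_chain`. -/
lemma card_mul_le_of_monotoneOn {T : Finset ℝ} {x y : ℝ → ℝ} {r ε η : ℝ} (hr : 0 < r)
    (hε : |ε| = 1) (hη : |η| = 1) (hx : MonotoneOn (fun t => ε * x t) T)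
    (hy : MonotoneOn (fun t => η * y t) T)
    (hx1 : ∀ t ∈ T, |x t| ≤ 1) (hy1 : ∀ t ∈ T, |y t| ≤ 1)
    (ho : ∀ a ∈ T, ∀ b ∈ T, ∀ c ∈ T, a < b → b < c → r ^ 3 ≤ orient x y a b c) :
    (T.card : ℝ) * r ≤ 2 * r + 3 := by
  rcases Nat.eq_zero_or_pos T.card with h0 | hpos
  · rw [h0]; push_cast; linarith
  obtain ⟨n, hn⟩ : ∃ n, T.card = n + 1 := ⟨T.card - 1, by omega⟩
  set f := T.orderEmbOfFin hn with hf
  set t : ℕ → ℝ := fun i => f ⟨min i n, by omega⟩ with ht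
  have hmem : ∀ i, t i ∈ T := fun i => T.orderEmbOfFin_mem hn _
  have hlt : ∀ i j, i < j → j ≤ n → t i < t j := fun i j hij hj => by
    simp only [ht]
    apply f.strictMono
    rw [Fin.mk_lt_mk]; omega
  have hεε : ε * ε = 1 := by rw [← abs_mul_abs_self, hε, one_mul]
  have hηη : η * η = 1 := by rw [← abs_mul_abs_self, hη, one_mul]
  rw [hn]
  push_cast
  refine card_monotone_chain (x := fun i => ε * x (t i)) (y := fun i => η * y (t i))
    (σ := ε * η) hr (by rw [abs_mul, hε, hη, one_mul]) ?_ ?_ ?_ ?_ ?_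
  · exact fun i hi => hx (hmem _) (hmem _) (hlt _ _ (by omega) (by omega)).le
  · exact fun i hi => hy (hmem _) (hmem _) (hlt _ _ (by omega) (by omega)).le
  · intro i _; rw [abs_mul, hε, one_mul]; exact hx1 _ (hmem _)
  · intro i _; rw [abs_mul, hη, one_mul]; exact hy1 _ (hmem _)
  · intro i hi
    have := ho _ (hmem i) _ (hmem (i + 1)) _ (hmem (i + 2)) (hlt _ _ (by omega) (by omega))
      (hlt _ _ (by omega) (by omega))
    have e : ε * η * orient (fun i => ε * x (t i)) (fun i => η * y (t i)) i (i + 1) (i + 2)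
        = (ε * ε) * (η * η) * orient x y (t i) (t (i + 1)) (t (i + 2)) := by
      simp only [orient]; ring
    rw [e, hεε, hηη]; linarith

/-- The diagonals of a convex quadrilateral cross. -/
lemma not_separated_of_orient_pos {x y : ℝ → ℝ} {a b c d s : ℝ} (h1 : 0 < orient x y b c d)
    (h2 : 0 < orient x y a c d) (h3 : 0 < orient x y a b d) (h4 : 0 < orient x y a b c)
    (ha : x a ≤ s) (hc : x c ≤ s) (hb : s ≤ x b) (hd : s ≤ x d)
    (h : x a < s ∨ x c < s ∨ s < x b ∨ s < x d) : False := by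
  -- The affine dependence of four points in the plane: positive weights on `a`, `c` balance
  -- positive weights on `b`, `d`, so no vertical line separates the two pairs.
  have e1 : orient x y b c d * x a - orient x y a c d * x b + orient x y a b d * x c
    - orient x y a b c * x d = 0 := by simp only [orient]; ring
  have e2 : orient x y b c d - orient x y a c d + orient x y a b d
    - orient x y a b c = 0 := by simp only [orient]; ring
  have m1 := mul_nonneg h1.le (sub_nonneg.2 ha)
  have m2 := mul_nonneg h2.le (sub_nonneg.2 hb)
  have m3 := mul_nonneg h3.le (sub_nonneg.2 hc)
  have m4 := mul_nonneg h4.le (sub_nonneg.2 hd)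
  have e3 : orient x y b c d * (s - x a) + orient x y a c d * (x b - s)
    + orient x y a b d * (s - x c) + orient x y a b c * (x d - s) = 0 := by linear_combination -e1 + s * e2
  rcases h with h | h | h | h
  · have := mul_pos h1 (sub_pos.2 h); linarith
  · have := mul_pos h3 (sub_pos.2 h); linarith
  · have := mul_pos h2 (sub_pos.2 h); linarith
  · have := mul_pos h4 (sub_pos.2 h); linarith

end TernaryForm

namespace TernaryForm

lemma card_mul_le_of_fibers {α κ : Type*} [DecidableEq κ] {T : Finset α} {K : Finset κ} {f : α → κ}
    {r B : ℝ} (hf : ∀ t ∈ T, f t ∈ K)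
    (h : ∀ k ∈ K, ((T.filter fun t => f t = k).card : ℝ) * r ≤ B) :
    (T.card : ℝ) * r ≤ K.card * B := by
  rw [Finset.card_eq_sum_card_fiberwise hf]
  push_cast
  rw [Finset.sum_mul]
  calc _ ≤ ∑ k ∈ K, B := Finset.sum_le_sum fun k hk => h k hk
    _ = _ := by simp

/-- The extremal points `p < q` cut the parameters into three ranges, on which `x` falls, rises and
falls. A pair `i < j` violating this forms with `p` and `q` a convex quadrilateral whose diagonals
are separated by a vertical line. The propositions `P` and `R` record in which range the whole of
`T'` lies. -/
lemma monotone_pieces_of_lt {T : Finset ℝ} {x y : ℝ → ℝ} {p q : ℝ} (hp : p ∈ T) (hq : q ∈ T)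
    (ho : ∀ a ∈ T, ∀ b ∈ T, ∀ c ∈ T, a < b → b < c → 0 < orient x y a b c)
    (hmin : ∀ t ∈ T, x p ≤ x t) (hmax : ∀ t ∈ T, x t ≤ x q) (hpq : p < q)
    {T' : Finset ℝ} (hT : T' ⊆ T) {P R : Prop} (h1 : ∀ t ∈ T', (t < p ↔ P))
    (h2 : ∀ t ∈ T', (t < q ↔ R)) :
    ∃ ε : ℝ, |ε| = 1 ∧ MonotoneOn (fun t => ε * x t) T' := by
  by_cases hP : P
  · refine ⟨-1, by simp, fun i hi j hj hij => ?_⟩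
    rcases hij.eq_or_lt with rfl | hij
    · rfl
    have hi' := hT hi
    have hj' := hT hj
    have hjp : j < p := (h1 j hj).2 hP
    by_contra! hlt
    refine not_separated_of_orient_pos (x := x) (y := y) (a := i) (b := j) (c := p) (d := q)
      (s := x j) (ho _ hj' _ hp _ hq hjp hpq) (ho _ hi' _ hp _ hq (hij.trans hjp) hpq)
      (ho _ hi' _ hj' _ hq hij (hjp.trans hpq)) (ho _ hi' _ hj' _ hp hij hjp)
      (by linarith) (hmin _ hj') le_rfl (hmax _ hj') (Or.inl (by linarith))
  by_cases hR : R
  · refine ⟨1, by simp, fun i hi j hj hij => ?_⟩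
    rcases hij.eq_or_lt with rfl | hij
    · rfl
    have hi' := hT hi
    have hj' := hT hj
    have hpi : p ≤ i := not_lt.1 fun h => hP ((h1 i hi).1 h)
    have hjq : j < q := (h2 j hj).2 hR
    by_contra! hlt
    rcases hpi.eq_or_lt with rfl | hpi
    · have := hmin j hj'; linarith
    refine not_separated_of_orient_pos (x := x) (y := y) (a := p) (b := i) (c := j) (d := q)
      (s := x i) (ho _ hi' _ hj' _ hq hij hjq) (ho _ hp _ hj' _ hq (hpi.trans hij) hjq)
      (ho _ hp _ hi' _ hq hpi (hij.trans hjq)) (ho _ hp _ hi' _ hj' hpi hij)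
      (hmin _ hi') (by linarith) le_rfl (hmax _ hi') (Or.inr (Or.inl (by linarith)))
  · refine ⟨-1, by simp, fun i hi j hj hij => ?_⟩
    rcases hij.eq_or_lt with rfl | hij
    · rfl
    have hi' := hT hi
    have hj' := hT hj
    have hqi : q ≤ i := not_lt.1 fun h => hR ((h2 i hi).1 h)
    by_contra! hlt
    rcases hqi.eq_or_lt with rfl | hqi
    · have := hmax j hj'; linarith
    refine not_separated_of_orient_pos (x := x) (y := y) (a := p) (b := q) (c := i) (d := j)
      (s := x j) (ho _ hq _ hi' _ hj' hqi hij) (ho _ hp _ hi' _ hj' (hpq.trans hqi) hij)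
      (ho _ hp _ hq _ hj' hpq (hqi.trans hij)) (ho _ hp _ hq _ hi' hpq hqi)
      (hmin _ hj') (by linarith) (hmax _ hj') le_rfl (Or.inr (Or.inl (by linarith)))

/-- A coordinate function on a convex chain is monotone away from its two extremal points. -/
lemma exists_monotone_pieces {T : Finset ℝ} {x y : ℝ → ℝ}
    (ho : ∀ a ∈ T, ∀ b ∈ T, ∀ c ∈ T, a < b → b < c → 0 < orient x y a b c) :
    ∃ p q : ℝ, ∀ T' ⊆ T, ∀ P R : Prop, (∀ t ∈ T', (t < p ↔ P)) → (∀ t ∈ T', (t < q ↔ R)) →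
      ∃ ε : ℝ, |ε| = 1 ∧ MonotoneOn (fun t => ε * x t) T' := by
  rcases T.eq_empty_or_nonempty with rfl | hne
  · refine ⟨0, 0, fun T' hT P R _ _ => ⟨1, by simp, ?_⟩⟩
    rw [Finset.subset_empty.1 hT]; simp [MonotoneOn]
  obtain ⟨p, hp, hmin⟩ := T.exists_min_image x hne
  obtain ⟨q, hq, hmax⟩ := T.exists_max_image x hne
  refine ⟨p, q, fun T' hT P R h1 h2 => ?_⟩
  rcases lt_trichotomy p q with h | rfl | h
  · exact monotone_pieces_of_lt hp hq ho hmin hmax h hT h1 h2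
  · refine ⟨1, by simp, fun i hi j hj _ => ?_⟩
    have := hmin j (hT hj)
    have := hmax i (hT hi)
    simp only [one_mul]; linarith
  -- A half turn preserves orientation and exchanges minimum and maximum.
  · obtain ⟨ε, hε, hm⟩ := monotone_pieces_of_lt (x := fun t => -x t) (y := fun t => -y t) hq hp
      (fun a ha b hb c hc hab hbc => by
        have := ho a ha b hb c hc hab hbc
        simp only [orient] at this ⊢; linarith)
      (fun t ht => neg_le_neg (hmax t ht)) (fun t ht => neg_le_neg (hmin t ht)) h hT h2 h1
    exact ⟨-ε, by rwa [abs_neg], by simpa using hm⟩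

/-- Points of `[-1, 1]²` in convex position, any three of which span a triangle of area bounded
below. -/
lemma card_mul_le_of_orient {T : Finset ℝ} {x y : ℝ → ℝ} {r : ℝ} (hr : 0 < r)
    (hx1 : ∀ t ∈ T, |x t| ≤ 1) (hy1 : ∀ t ∈ T, |y t| ≤ 1)
    (ho : ∀ a ∈ T, ∀ b ∈ T, ∀ c ∈ T, a < b → b < c → r ^ 3 ≤ orient x y a b c) :
    (T.card : ℝ) * r ≤ 16 * (2 * r + 3) := by
  have hr3 : 0 < r ^ 3 := by positivity
  obtain ⟨p, q, h1⟩ := exists_monotone_pieces (T := T) (x := x) (y := y)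
    fun a ha b hb c hc hab hbc => hr3.trans_le (ho a ha b hb c hc hab hbc)
  -- A quarter turn preserves orientation and brings `y` into the place of `x`. The four cut points
  -- then give at most `2 ^ 4 = 16` pieces on which both coordinates are monotone.
  obtain ⟨p', q', h2⟩ := exists_monotone_pieces (T := T) (x := y) (y := fun t => -x t)
    fun a ha b hb c hc hab hbc => by
      have := hr3.trans_le (ho a ha b hb c hc hab hbc)
      simp only [orient] at this ⊢; linarith
  classical
  have := card_mul_le_of_fibers (T := T) (K := (Finset.univ : Finset (Bool × Bool × Bool × Bool)))
    (f := fun t => (decide (t < p), decide (t < q), decide (t < p'), decide (t < q')))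
    (r := r) (B := 2 * r + 3) (fun _ _ => Finset.mem_univ _) ?_
  · simpa using this
  rintro ⟨b1, b2, b3, b4⟩ -
  set T' := T.filter fun t => (decide (t < p), decide (t < q), decide (t < p'), decide (t < q'))
    = (b1, b2, b3, b4) with hT'
  have hsub : T' ⊆ T := Finset.filter_subset _ _
  have hm : ∀ t ∈ T', ((t < p ↔ b1 = true) ∧ (t < q ↔ b2 = true)) ∧
      ((t < p' ↔ b3 = true) ∧ (t < q' ↔ b4 = true)) := fun t ht => by
    have := (Finset.mem_filter.1 ht).2
    simp only [Prod.mk.injEq] at this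
    obtain ⟨rfl, rfl, rfl, rfl⟩ := this
    simp
  obtain ⟨ε, hε, m1⟩ := h1 T' hsub _ _ (fun t ht => (hm t ht).1.1) (fun t ht => (hm t ht).1.2)
  obtain ⟨η, hη, m2⟩ := h2 T' hsub _ _ (fun t ht => (hm t ht).2.1) (fun t ht => (hm t ht).2.2)
  exact card_mul_le_of_monotoneOn hr hε hη m1 m2 (fun t ht => hx1 t (hsub ht))
    (fun t ht => hy1 t (hsub ht)) fun a ha b hb c hc => ho a (hsub ha) b (hsub hb) c (hsub hc)

end TernaryForm

/-! ### Primitive integer points on a real conic. -/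

namespace TernaryForm

open Matrix

/-- The determinant of the matrix with rows `u`, `v`, `w`. -/
def det3 {R : Type*} [CommRing R] (u v w : Fin 3 → R) : R :=
  u 0 * (v 1 * w 2 - v 2 * w 1) + u 1 * (v 2 * w 0 - v 0 * w 2) + u 2 * (v 0 * w 1 - v 1 * w 0)

lemma det3_eq_det {R : Type*} [CommRing R] (u v w : Fin 3 → R) :
    det3 u v w = (Matrix.of ![u, v, w]).det := by
  rw [det_fin_three]; simp [det3]; ring

/-- The bilinear form of a symmetric matrix. -/
def bil {R : Type*} [CommRing R] (M : Matrix (Fin 3) (Fin 3) R) (u v : Fin 3 → R) : R :=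
  u ⬝ᵥ M *ᵥ v

lemma bil_eq {R : Type*} [CommRing R] (M : Matrix (Fin 3) (Fin 3) R) (u v : Fin 3 → R) :
    bil M u v = u 0 * (M 0 0 * v 0 + M 0 1 * v 1 + M 0 2 * v 2)
      + u 1 * (M 1 0 * v 0 + M 1 1 * v 1 + M 1 2 * v 2)
      + u 2 * (M 2 0 * v 0 + M 2 1 * v 1 + M 2 2 * v 2) := by
  simp [bil, dotProduct, mulVec, Fin.sum_univ_three]

lemma bil_comm {R : Type*} [CommRing R] {M : Matrix (Fin 3) (Fin 3) R} (hM : M.IsSymm)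
    (u v : Fin 3 → R) : bil M u v = bil M v u := by
  rw [bil_eq, bil_eq, hM.apply 0 1, hM.apply 0 2, hM.apply 1 2]; ring

/-- The determinant of the Gram matrix of three vectors. -/
lemma gram_det {R : Type*} [CommRing R] {M : Matrix (Fin 3) (Fin 3) R} (hM : M.IsSymm)
    (u v w : Fin 3 → R) :
    det3 u v w ^ 2 * M.det = bil M u u * (bil M v v * bil M w w - bil M v w ^ 2)
      - bil M u v * (bil M u v * bil M w w - bil M v w * bil M u w)
      + bil M u w * (bil M u v * bil M v w - bil M v v * bil M u w) := by
  have h : det3 u v w ^ 2 * M.det = (of ![u, v, w] * M * (of ![u, v, w])ᵀ).det := by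
    rw [det_mul, det_mul, det_transpose, ← det3_eq_det]; ring
  have hG : ∀ i j, (of ![u, v, w] * M * (of ![u, v, w])ᵀ) i j
      = bil M (![u, v, w] i) (![u, v, w] j) := fun i j => by
    rw [Matrix.mul_assoc]
    simp [bil, mul_apply, dotProduct, mulVec]
  rw [h, det_fin_three]
  simp only [hG]
  simp only [cons_val_zero, cons_val_one, cons_val]
  rw [bil_comm hM v u, bil_comm hM w u, bil_comm hM w v]; ring

lemma exists_combination {P : Matrix (Fin 3) (Fin 3) ℝ} (hP : P.det ≠ 0) (y : Fin 3 → ℝ) :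
    ∃ x : Fin 3 → ℝ, ∀ i, y i = x 0 * P 0 i + x 1 * P 1 i + x 2 * P 2 i := by
  refine ⟨y ᵥ* P⁻¹, fun i => ?_⟩
  have h : (y ᵥ* P⁻¹) ᵥ* P = y := by
    rw [vecMul_vecMul, nonsing_inv_mul _ (isUnit_iff_ne_zero.2 hP), vecMul_one]
  conv_lhs => rw [← h]
  simp [vecMul, dotProduct, Fin.sum_univ_three]

/-- The parametrisation of a smooth real conic by the lines through one of its points. -/
lemma exists_parametrization {M : Matrix (Fin 3) (Fin 3) ℝ} (hM : M.IsSymm) (hdet : M.det ≠ 0)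
    {e : Fin 3 → ℝ} (he : e ≠ 0) (hee : bil M e e = 0) :
    ∃ p q s : Fin 3 → ℝ, det3 p q s ≠ 0 ∧ ∀ y, bil M y y = 0 →
      (∃ c : ℝ, y = c • e) ∨ ∃ c ≠ 0, ∃ t : ℝ, ∀ i, y i = c * (p i + t * q i + t ^ 2 * s i) := by
  -- `n` is the normal of the tangent plane to the cone along `e`. Since `e · n = bil M e e = 0`,
  -- the vectors `e`, `g = e × n` and `n` form an Euclidean orthogonal basis, and `g` is tangent.
  set n : Fin 3 → ℝ := M *ᵥ e with hn
  have hne : n ≠ 0 := fun h => he (eq_zero_of_mulVec_eq_zero hdet h)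
  have hen : e 0 * n 0 + e 1 * n 1 + e 2 * n 2 = 0 := by
    rw [← hee]; simp [bil, dotProduct, Fin.sum_univ_three, hn]
  have hnorm : ∀ z : Fin 3 → ℝ, z ≠ 0 → 0 < z 0 ^ 2 + z 1 ^ 2 + z 2 ^ 2 := fun z hz => by
    by_contra! h
    have h0 : z 0 = 0 := by nlinarith [sq_nonneg (z 0), sq_nonneg (z 1), sq_nonneg (z 2)]
    have h1 : z 1 = 0 := by nlinarith [sq_nonneg (z 0), sq_nonneg (z 1), sq_nonneg (z 2)]
    have h2 : z 2 = 0 := by nlinarith [sq_nonneg (z 0), sq_nonneg (z 1), sq_nonneg (z 2)]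
    exact hz (by ext i; fin_cases i <;> assumption)
  have hbe : ∀ z, bil M z e = z 0 * n 0 + z 1 * n 1 + z 2 * n 2 := fun z => by
    simp [bil, dotProduct, Fin.sum_univ_three, hn]
  set g : Fin 3 → ℝ := ![e 1 * n 2 - e 2 * n 1, e 2 * n 0 - e 0 * n 2, e 0 * n 1 - e 1 * n 0]
    with hg
  have hge : bil M e g = 0 := by
    rw [bil_comm hM, hbe]; simp [hg]; ring
  have hh : 0 < bil M e n := by
    rw [bil_comm hM, hbe]; have := hnorm n hne; nlinarith
  have hd : det3 e g n ≠ 0 := by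
    have : det3 e g n = -((e 0 ^ 2 + e 1 ^ 2 + e 2 ^ 2) * (n 0 ^ 2 + n 1 ^ 2 + n 2 ^ 2)) := by
      simp only [det3, hg, cons_val_zero, cons_val_one, cons_val]
      linear_combination (e 0 * n 0 + e 1 * n 1 + e 2 * n 2) * hen
    rw [this]
    exact neg_ne_zero.2 (mul_pos (hnorm e he) (hnorm n hne)).ne'
  -- If it vanished, `e` and `g` would span a totally isotropic plane, making the Gram matrix of
  -- `e`, `g`, `n` singular.
  have hG : bil M g g ≠ 0 := by
    intro h0
    have := gram_det hM e g n
    rw [hee, hge, h0] at this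
    have h2 : det3 e g n ^ 2 * M.det ≠ 0 := mul_ne_zero (pow_ne_zero _ hd) hdet
    exact h2 (by rw [this]; ring)
  set h := bil M e n with hhdef
  set G := bil M g g with hGdef
  set k := bil M g n with hk
  set W := bil M n n with hW
  refine ⟨fun i => n i - W / (2 * h) * e i, fun i => g i - k / h * e i,
    fun i => -(G / (2 * h)) * e i, ?_, fun y hy => ?_⟩
  · have : det3 (fun i => n i - W / (2 * h) * e i) (fun i => g i - k / h * e i)
      (fun i => -(G / (2 * h)) * e i) = G / (2 * h) * det3 e g n := by
      simp only [det3]; ring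
    rw [this]
    exact mul_ne_zero (div_ne_zero hG (by positivity)) hd
  · obtain ⟨x, hx⟩ := exists_combination (P := of ![e, g, n]) (by rwa [← det3_eq_det]) y
    simp only [of_apply, cons_val_zero, cons_val_one, cons_val] at hx
    have hyy : bil M y y = 2 * x 0 * x 2 * h + x 1 ^ 2 * G + 2 * x 1 * x 2 * k + x 2 ^ 2 * W := by
      have : bil M y y = x 0 ^ 2 * bil M e e + 2 * x 0 * x 1 * bil M e g + 2 * x 0 * x 2 * h
          + x 1 ^ 2 * G + 2 * x 1 * x 2 * k + x 2 ^ 2 * W := by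
        simp only [hhdef, hGdef, hk, hW]
        rw [bil_eq, bil_eq, bil_eq, bil_eq, bil_eq, bil_eq, bil_eq, hx 0, hx 1, hx 2,
          hM.apply 0 1, hM.apply 0 2, hM.apply 1 2]
        ring
      rw [this, hee, hge]; ring
    by_cases hc : x 2 = 0
    · left
      have h1 : x 1 = 0 := by
        have : x 1 ^ 2 * G = 0 := by rw [hyy, hc] at hy; linarith
        simpa [hG] using this
      refine ⟨x 0, funext fun i => ?_⟩
      rw [hx i, h1, hc]; simp
    · right
      -- Since `e` is isotropic, the equation is linear in the coordinate `x 0` along `e`, which is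
      -- therefore a quadratic function of `t` up to the scale `x 2`.
      refine ⟨x 2, hc, x 1 / x 2, fun i => ?_⟩
      have h0 : x 0 = -(x 1 ^ 2 * G + 2 * x 1 * x 2 * k + x 2 ^ 2 * W) / (2 * h * x 2) := by
        rw [eq_div_iff (by positivity)]; linarith
      rw [hx i, h0]; field_simp; ring

/-- Proportional primitive integer vectors agree up to sign. -/
lemma eq_or_eq_neg_of_primitive {u v : Fin 3 → ℤ} (hu : Finset.univ.gcd u = 1)
    (hv : Finset.univ.gcd v = 1) (h : ∀ i j, u i * v j = u j * v i) : u = v ∨ u = -v := by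
  have key : ∀ {u v : Fin 3 → ℤ}, Finset.univ.gcd v = 1 → (∀ i j, u i * v j = u j * v i) →
      ∀ i, v i ∣ u i := fun {u v} hv h i => by
    have h1 : v i ∣ Finset.univ.gcd fun j => u i * v j :=
      Finset.dvd_gcd fun j _ => by rw [h i j]; exact dvd_mul_left _ _
    rw [Finset.gcd_mul_left, hv, mul_one] at h1
    exact (dvd_normalize_iff).1 h1
  have h1 := key hv h
  have h2 := key (u := v) hu fun i j => by linarith [h i j]
  have hne : ∃ i, v i ≠ 0 := by
    by_contra! h0
    have : Finset.univ.gcd v = 0 := Finset.gcd_eq_zero_iff.2 fun i _ => h0 i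
    omega
  obtain ⟨i, hi⟩ := hne
  rcases Int.associated_iff.1 (associated_of_dvd_dvd (h2 i) (h1 i)) with e | e
  · left; ext j
    have := h i j
    rw [e, mul_comm (u j)] at this
    exact (mul_left_cancel₀ hi this).symm
  · right; ext j
    have := h i j
    have hu0 : u i ≠ 0 := by intro h0; rw [h0] at e; simp at e; exact hi e
    have : u i * v j = u i * -u j := by
      rw [this, e, Int.neg_mul_neg]; exact mul_comm _ _
    have := mul_left_cancel₀ hu0 this
    simp; omega

end TernaryForm

namespace TernaryForm

open Matrix

lemma det3_cyclic {R : Type*} [CommRing R] (k : Fin 3) (u v w : Fin 3 → R) :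
    det3 u v w = u k * (v (k + 1) * w (k + 2) - v (k + 2) * w (k + 1))
      + u (k + 1) * (v (k + 2) * w k - v k * w (k + 2))
      + u (k + 2) * (v k * w (k + 1) - v (k + 1) * w k) := by
  fin_cases k <;> simp [det3] <;> ring

lemma prod_cyclic {R : Type*} [CommRing R] (k : Fin 3) (B : Fin 3 → R) :
    B k * B (k + 1) * B (k + 2) = B 0 * B 1 * B 2 := by
  fin_cases k <;> simp <;> ring

/-- A Vandermonde determinant: its sign depends only on the order of the parameters, which is why
the points are in convex position. -/
lemma det3_quadratic (p q s : Fin 3 → ℝ) (a b c : ℝ) :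
    det3 (fun i => p i + a * q i + a ^ 2 * s i) (fun i => p i + b * q i + b ^ 2 * s i)
      (fun i => p i + c * q i + c ^ 2 * s i)
      = det3 p q s * ((b - a) * (c - a) * (c - b)) := by
  simp only [det3]; ring

lemma det3_smul {R : Type*} [CommRing R] (a b c : R) (u v w : Fin 3 → R) :
    det3 (fun i => a * u i) (fun i => b * v i) (fun i => c * w i) = a * b * c * det3 u v w := by
  simp only [det3]; ring

/-- In the affine chart where coordinate `k` is non-zero, rescaled by `B`. -/
lemma orient_chart (k : Fin 3) {f : ℝ → Fin 3 → ℝ} {B : Fin 3 → ℝ} (hB : ∀ i, 0 < B i)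
    {a b c : ℝ} (ha : f a k ≠ 0) (hb : f b k ≠ 0) (hc : f c k ≠ 0) :
    orient (fun t => f t (k + 1) / f t k * (B k / B (k + 1)))
      (fun t => f t (k + 2) / f t k * (B k / B (k + 2))) a b c
      = det3 (f a) (f b) (f c) / (f a k * f b k * f c k)
        * (B k ^ 3 / (B 0 * B 1 * B 2)) := by
  have h1 := (hB (k + 1)).ne'
  have h2 := (hB (k + 2)).ne'
  have h0 := (hB k).ne'
  rw [← prod_cyclic k B, det3_cyclic k]
  simp only [orient]
  field_simp
  ring

/-- The points with a given parameter on one sheet of the cone, in one chart. -/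
lemma card_sheet_le {X : Finset (Fin 3 → ℤ)} {B : Fin 3 → ℝ} {r : ℝ} {p q s : Fin 3 → ℝ}
    {c t : (Fin 3 → ℤ) → ℝ} {k : Fin 3} {σ ρ : ℝ} (hB : ∀ i, 0 < B i) (hr : 0 < r)
    (hprim : ∀ y ∈ X, Finset.univ.gcd y = 1) (hbox : ∀ y ∈ X, |(y k : ℝ)| ≤ B k)
    (hd : ∀ u ∈ X, ∀ v ∈ X, ∀ w ∈ X, det3 u v w ≠ 0 →
      r ^ 3 * (B 0 * B 1 * B 2) ≤ |((det3 u v w : ℤ) : ℝ)|)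
    (hpqs : det3 p q s ≠ 0)
    (hy : ∀ y ∈ X, ∀ i, (y i : ℝ) = c y * (p i + t y * q i + t y ^ 2 * s i))
    (hface : ∀ y ∈ X, ∀ i, |(y i : ℝ)| / B i ≤ |(y k : ℝ)| / B k)
    (hσ : ∀ y ∈ X, 0 < σ * y k) (hρ : ∀ y ∈ X, 0 < ρ * c y) :
    (X.card : ℝ) * r ≤ 16 * (2 * r + 3) := by
  classical
  have hc : ∀ y ∈ X, c y ≠ 0 := fun y hyX h => by
    have := hρ y hyX; rw [h, mul_zero] at this; exact lt_irrefl _ this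
  have hk0 : ∀ y ∈ X, (y k : ℝ) ≠ 0 := fun y hyX h => by
    have := hσ y hyX; rw [h, mul_zero] at this; exact lt_irrefl _ this
  -- Equal parameters mean proportional vectors, hence equal up to sign by primitivity; the fixed
  -- sign of coordinate `k` excludes the opposite vector.
  have hinj : Set.InjOn t X := by
    intro u hu v hv huv
    have hprop : ∀ i j, u i * v j = u j * v i := fun i j => by
      have : (u i : ℝ) * v j = u j * v i := by
        rw [hy u hu i, hy u hu j, hy v hv i, hy v hv j, huv]; ring
      exact_mod_cast this
    rcases eq_or_eq_neg_of_primitive (hprim u hu) (hprim v hv) hprop with h | h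
    · exact h
    · exfalso
      have h1 := hσ u hu
      have h2 := hσ v hv
      rw [h] at h1
      push_cast [Pi.neg_apply] at h1
      linarith
  rw [← Finset.card_image_of_injOn hinj]
  set f : ℝ → Fin 3 → ℝ := fun τ i => p i + τ * q i + τ ^ 2 * s i with hf
  have hfy : ∀ y ∈ X, ∀ i, (y i : ℝ) = c y * f (t y) i := fun y hyX i => hy y hyX i
  have hfk : ∀ y ∈ X, f (t y) k ≠ 0 := fun y hyX h => hk0 y hyX (by rw [hfy y hyX, h, mul_zero])
  have hbd : ∀ y ∈ X, ∀ i, |f (t y) i / f (t y) k * (B k / B i)| ≤ 1 := fun y hyX i => by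
    have e : f (t y) i / f (t y) k = (y i : ℝ) / y k := by
      rw [hfy y hyX i, hfy y hyX k, mul_div_mul_left _ _ (hc y hyX)]
    have h1 := hface y hyX i
    have h2 := hB i
    have h3 := hB k
    have h4 := abs_pos.2 (hk0 y hyX)
    rw [e, abs_mul, abs_div, abs_div, abs_of_pos h2, abs_of_pos h3, div_mul_div_comm,
      div_le_one (by positivity)]
    rw [div_le_div_iff₀ h2 h3] at h1
    exact h1
  have hVB : 0 < B 0 * B 1 * B 2 := mul_pos (mul_pos (hB 0) (hB 1)) (hB 2)
  -- The doubled area in the chart is `|det| / |u_k v_k w_k|` times `B_k³ / (B₀B₁B₂)`; the bounds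
  -- `|y_k| ≤ B_k` only help.
  have habs : ∀ u ∈ X, ∀ v ∈ X, ∀ w ∈ X, t u < t v → t v < t w →
      r ^ 3 ≤ |det3 (f (t u)) (f (t v)) (f (t w)) / (f (t u) k * f (t v) k * f (t w) k)
        * (B k ^ 3 / (B 0 * B 1 * B 2))| := by
    intro u hu v hv w hw huv hvw
    have e : ((det3 u v w : ℤ) : ℝ)
        = c u * c v * c w * det3 (f (t u)) (f (t v)) (f (t w)) := by
      rw [← det3_smul]
      simp only [← hfy u hu, ← hfy v hv, ← hfy w hw]
      simp [det3]
    have hne : ((det3 u v w : ℤ) : ℝ) ≠ 0 := by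
      rw [e, hf, det3_quadratic]
      have := hc u hu
      have := hc v hv
      have := hc w hw
      have h1 := sub_pos.2 huv
      have h2 := sub_pos.2 hvw
      have h3 := sub_pos.2 (huv.trans hvw)
      positivity
    have h1 := hd u hu v hv w hw (by exact_mod_cast hne)
    have e2 : det3 (f (t u)) (f (t v)) (f (t w)) / (f (t u) k * f (t v) k * f (t w) k)
        = ((det3 u v w : ℤ) : ℝ) / (u k * v k * w k) := by
      rw [e, hfy u hu, hfy v hv, hfy w hw]
      have := hc u hu
      have := hc v hv
      have := hc w hw
      have := hfk u hu
      have := hfk v hv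
      have := hfk w hw
      field_simp
    rw [e2, abs_mul, abs_div, abs_of_pos (div_pos (pow_pos (hB k) 3) hVB), div_mul_div_comm,
      le_div_iff₀ (mul_pos (abs_pos.2 (mul_ne_zero (mul_ne_zero (hk0 u hu) (hk0 v hv))
        (hk0 w hw))) hVB)]
    have h2 : |(u k : ℝ) * v k * w k| ≤ B k ^ 3 := by
      rw [abs_mul, abs_mul, pow_succ, pow_two]
      have := hbox u hu
      have := hbox v hv
      have := hbox w hw
      have := (hB k).le
      gcongr
    calc r ^ 3 * (|(u k : ℝ) * v k * w k| * (B 0 * B 1 * B 2))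
        = (r ^ 3 * (B 0 * B 1 * B 2)) * |(u k : ℝ) * v k * w k| := by ring
      _ ≤ |((det3 u v w : ℤ) : ℝ)| * B k ^ 3 := by gcongr
  -- Fixing the signs of `c y` and of `y k` fixes the sign of the chart denominator `f (t y) k`, so
  -- all orientations with increasing parameters have one common sign.
  have hsgn : ∀ y ∈ X, 0 < (ρ * σ) * f (t y) k := fun y hyX => by
    have h1 := hσ y hyX
    have h2 := hρ y hyX
    rw [hfy y hyX k] at h1
    have h3 : 0 < (ρ * c y) * (σ * (c y * f (t y) k)) := mul_pos h2 h1
    have h4 : 0 < c y ^ 2 := by have := hc y hyX; positivity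
    have h5 : (ρ * c y) * (σ * (c y * f (t y) k)) = c y ^ 2 * ((ρ * σ) * f (t y) k) := by ring
    rw [h5] at h3
    exact (pos_iff_pos_of_mul_pos h3).1 h4
  have hpos : ∀ u ∈ X, ∀ v ∈ X, ∀ w ∈ X, t u < t v → t v < t w →
      0 < (det3 p q s * (ρ * σ)) * (det3 (f (t u)) (f (t v)) (f (t w)) /
        (f (t u) k * f (t v) k * f (t w) k) * (B k ^ 3 / (B 0 * B 1 * B 2))) := by
    intro u hu v hv w hw huv hvw
    have h1 := sub_pos.2 huv
    have h2 := sub_pos.2 hvw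
    have h3 := sub_pos.2 (huv.trans hvw)
    have hs0 : ρ * σ ≠ 0 := fun h => by
      have := hsgn u hu; rw [h, zero_mul] at this; exact lt_irrefl _ this
    have hs := mul_pos (mul_pos (hsgn u hu) (hsgn v hv)) (hsgn w hw)
    have hBk := hB k
    have e : (det3 p q s * (ρ * σ)) * (det3 (f (t u)) (f (t v)) (f (t w)) /
        (f (t u) k * f (t v) k * f (t w) k) * (B k ^ 3 / (B 0 * B 1 * B 2)))
        = det3 p q s ^ 2 * (ρ * σ) ^ 4 * ((t v - t u) * (t w - t u) * (t w - t v))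
          / (ρ * σ * f (t u) k * (ρ * σ * f (t v) k) * (ρ * σ * f (t w) k))
          * (B k ^ 3 / (B 0 * B 1 * B 2)) := by
      rw [hf, det3_quadratic]
      have := hfk u hu
      have := hfk v hv
      have := hfk w hw
      have hρ0 := left_ne_zero_of_mul hs0
      have hσ0 := right_ne_zero_of_mul hs0
      simp only [hf] at *
      field_simp
    rw [e]
    positivity
  have hcase : 0 < det3 p q s * (ρ * σ) ∨ det3 p q s * (ρ * σ) ≤ 0 := lt_or_ge _ _
  rcases hcase with hcase | hcase
  · refine card_mul_le_of_orient (x := fun τ => f τ (k + 1) / f τ k * (B k / B (k + 1)))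
      (y := fun τ => f τ (k + 2) / f τ k * (B k / B (k + 2))) hr ?_ ?_ ?_
    · simp only [Finset.forall_mem_image]; exact fun y hyX => hbd y hyX _
    · simp only [Finset.forall_mem_image]; exact fun y hyX => hbd y hyX _
    · simp only [Finset.forall_mem_image]
      intro u hu v hv w hw huv hvw
      rw [orient_chart k hB (hfk u hu) (hfk v hv) (hfk w hw)]
      have h1 := habs u hu v hv w hw huv hvw
      rwa [abs_of_pos ((pos_iff_pos_of_mul_pos (hpos u hu v hv w hw huv hvw)).1 hcase)] at h1
  -- Exchanging the two chart coordinates makes the orientations positive.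
  · refine card_mul_le_of_orient (x := fun τ => f τ (k + 2) / f τ k * (B k / B (k + 2)))
      (y := fun τ => f τ (k + 1) / f τ k * (B k / B (k + 1))) hr ?_ ?_ ?_
    · simp only [Finset.forall_mem_image]; exact fun y hyX => hbd y hyX _
    · simp only [Finset.forall_mem_image]; exact fun y hyX => hbd y hyX _
    · simp only [Finset.forall_mem_image]
      intro u hu v hv w hw huv hvw
      have e := orient_chart k hB (hfk u hu) (hfk v hv) (hfk w hw)
      have h1 := habs u hu v hv w hw huv hvw
      have h2 := hpos u hu v hv w hw huv hvw
      have h3 := neg_of_mul_pos_right h2 hcase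
      rw [abs_of_neg h3, ← e] at h1
      simp only [orient] at h1 ⊢
      linarith

/-- Primitive integer points of a box on a smooth conic, any three of which are either dependent
or span a parallelepiped of large volume. -/
lemma card_conic_le {X : Finset (Fin 3 → ℤ)} {B : Fin 3 → ℝ} {r : ℝ}
    {M : Matrix (Fin 3) (Fin 3) ℝ} (hM : M.IsSymm) (hdet : M.det ≠ 0)
    {e : Fin 3 → ℝ} (he : e ≠ 0) (hee : bil M e e = 0) (hB : ∀ i, 0 < B i) (hr : 0 < r)
    (hprim : ∀ y ∈ X, Finset.univ.gcd y = 1)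
    (hzero : ∀ y ∈ X, bil M (fun i => (y i : ℝ)) (fun i => (y i : ℝ)) = 0)
    (hbox : ∀ y ∈ X, ∀ i, |(y i : ℝ)| ≤ B i)
    (hd : ∀ u ∈ X, ∀ v ∈ X, ∀ w ∈ X, det3 u v w ≠ 0 →
      r ^ 3 * (B 0 * B 1 * B 2) ≤ |((det3 u v w : ℤ) : ℝ)|) :
    (X.card : ℝ) * r ≤ 416 * r + 624 := by
  classical
  obtain ⟨p, q, s, hpqs, hpar⟩ := exists_parametrization hM hdet he hee
  -- The parametrisation misses the point `e` itself, which accounts for at most two primitive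
  -- vectors.
  set Y := X.filter fun y => ∃ c : ℝ, (fun i => (y i : ℝ)) = c • e with hY
  set Z := X.filter fun y => ¬ ∃ c : ℝ, (fun i => (y i : ℝ)) = c • e with hZ
  have hcard : X.card = Y.card + Z.card := (Finset.card_filter_add_card_filter_not _).symm
  have hYc : Y.card ≤ 2 := by
    rcases Y.eq_empty_or_nonempty with h | ⟨v, hv⟩
    · rw [h]; simp
    · have : Y ⊆ {v, -v} := fun u hu => by
        obtain ⟨hu, a, ha⟩ := Finset.mem_filter.1 hu
        obtain ⟨hv, b, hb⟩ := Finset.mem_filter.1 hv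
        have := eq_or_eq_neg_of_primitive (hprim u hu) (hprim v hv) fun i j => by
          have h1 := fun i => congrFun ha i
          have h2 := fun i => congrFun hb i
          simp only [Pi.smul_apply, smul_eq_mul] at h1 h2
          have : (u i : ℝ) * v j = u j * v i := by rw [h1, h1, h2, h2]; ring
          exact_mod_cast this
        simpa using this
      exact (Finset.card_le_card this).trans Finset.card_le_two
  have hex : ∀ y : Fin 3 → ℤ, ∃ ct : ℝ × ℝ, y ∈ Z → ct.1 ≠ 0 ∧
      ∀ i, (y i : ℝ) = ct.1 * (p i + ct.2 * q i + ct.2 ^ 2 * s i) := fun y => by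
    by_cases hy : y ∈ Z
    · obtain ⟨hyX, hn⟩ := Finset.mem_filter.1 hy
      rcases hpar _ (hzero y hyX) with h | ⟨c, hc, t, h⟩
      · exact absurd h hn
      · exact ⟨(c, t), fun _ => ⟨hc, h⟩⟩
    · exact ⟨0, fun h => absurd h hy⟩
  choose ct hct using hex
  have hface : ∀ y : Fin 3 → ℤ, ∃ k, ∀ i, |(y i : ℝ)| / B i ≤ |(y k : ℝ)| / B k := fun y =>
    Finite.exists_max fun i => |(y i : ℝ)| / B i
  choose k hk using hface
  -- Three faces of the box and two signs give 12 sheets of at most `16 (2r + 3)` each; the target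
  -- `416 r + 624` is 13 times that, the last share covering `Y`.
  have hfib := card_mul_le_of_fibers (T := Z) (K := (Finset.univ : Finset (Fin 3 × Bool × Bool)))
    (f := fun y => (k y, decide (0 < y (k y)), decide (0 < (ct y).1)))
    (r := r) (B := 16 * (2 * r + 3)) (fun _ _ => Finset.mem_univ _) ?_
  · have : (Y.card : ℝ) ≤ 2 := by exact_mod_cast hYc
    rw [hcard]
    push_cast
    simp at hfib
    nlinarith
  rintro ⟨k0, b1, b2⟩ -
  have hmem : ∀ y ∈ Z.filter (fun y => (k y, decide (0 < y (k y)), decide (0 < (ct y).1))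
      = (k0, b1, b2)), y ∈ X ∧ y ∈ Z ∧ k y = k0 ∧ (0 < y k0 ↔ b1 = true) ∧
        (0 < (ct y).1 ↔ b2 = true) := fun y hy => by
    obtain ⟨hyZ, h⟩ := Finset.mem_filter.1 hy
    simp only [Prod.mk.injEq] at h
    obtain ⟨rfl, rfl, rfl⟩ := h
    exact ⟨(Finset.mem_filter.1 hyZ).1, hyZ, rfl, by simp, by simp⟩
  refine card_sheet_le (k := k0) (c := fun y => (ct y).1) (t := fun y => (ct y).2)
    (σ := if b1 then 1 else -1) (ρ := if b2 then 1 else -1) hB hr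
    (fun y hy => hprim y (hmem y hy).1) (fun y hy => hbox y (hmem y hy).1 _)
    (fun u hu v hv w hw => hd u (hmem u hu).1 v (hmem v hv).1 w (hmem w hw).1) hpqs
    (fun y hy => (hct y (hmem y hy).2.1).2) (fun y hy => by
      have := hk y; rwa [(hmem y hy).2.2.1] at this) (fun y hy => ?_) (fun y hy => ?_)
  · obtain ⟨hyX, -, h1, h2, -⟩ := hmem y hy
    have hne : y k0 ≠ 0 := fun h0 => by
      have hall : ∀ i, y i = 0 := fun i => by
        have := hk y i
        rw [h1, h0] at this
        simp only [Int.cast_zero, abs_zero, zero_div] at this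
        have h3 := (div_le_iff₀ (hB i)).1 this
        rw [zero_mul] at h3
        exact_mod_cast abs_nonpos_iff.1 h3
      have : Finset.univ.gcd y = 0 := Finset.gcd_eq_zero_iff.2 fun i _ => hall i
      have := hprim y hyX
      omega
    by_cases hb : b1 = true
    · have := h2.2 hb
      simp only [hb, if_true, one_mul]; exact_mod_cast this
    · have h3 : y k0 < 0 := by
        rcases lt_trichotomy (y k0) 0 with h | h | h
        · exact h
        · exact absurd h hne
        · exact absurd (h2.1 h) hb
      have : (y k0 : ℝ) < 0 := by exact_mod_cast h3
      simp only [hb]; simpa using this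
  · obtain ⟨-, hyZ, -, -, h2⟩ := hmem y hy
    have hne := (hct y hyZ).1
    by_cases hb : b2 = true
    · have := h2.2 hb
      simpa only [hb, if_true, one_mul]
    · have h3 : (ct y).1 < 0 := by
        rcases lt_trichotomy (ct y).1 0 with h | h | h
        · exact h
        · exact absurd h hne
        · exact absurd (h2.1 h) hb
      simp only [hb]; simpa using h3

end TernaryForm

/-! ### Diagonalisation of symmetric bilinear forms over a valuation ring. -/

namespace TernaryForm

open Matrix

section Diagonalization

variable {R : Type*} [CommRing R]

lemma bil_add_left (M : Matrix (Fin 3) (Fin 3) R) (u v w : Fin 3 → R) :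
    bil M (u + v) w = bil M u w + bil M v w := by simp [bil, add_dotProduct]

lemma bil_add_right (M : Matrix (Fin 3) (Fin 3) R) (u v w : Fin 3 → R) :
    bil M u (v + w) = bil M u v + bil M u w := by simp [bil, mulVec_add, dotProduct_add]

lemma bil_smul_left (M : Matrix (Fin 3) (Fin 3) R) (c : R) (u v : Fin 3 → R) :
    bil M (c • u) v = c * bil M u v := by simp [bil, smul_dotProduct]

lemma bil_smul_right (M : Matrix (Fin 3) (Fin 3) R) (c : R) (u v : Fin 3 → R) :
    bil M u (c • v) = c * bil M u v := by simp [bil, mulVec_smul, dotProduct_smul]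

lemma exists_dvd_forall [PreValuationRing R] {ι : Type*} (s : Finset ι) (hs : s.Nonempty)
    (g : ι → R) : ∃ i ∈ s, ∀ j ∈ s, g i ∣ g j := by
  classical
  induction hs using Finset.Nonempty.cons_induction with
  | singleton a => exact ⟨a, by simp, by simp⟩
  | cons a s ha hs ih =>
    obtain ⟨i, hi, h⟩ := ih
    rcases ValuationRing.dvd_total (g a) (g i) with hd | hd
    · exact ⟨a, by simp, fun j hj => by
        rcases Finset.mem_cons.1 hj with rfl | hj
        · rfl
        · exact hd.trans (h j hj)⟩
    · exact ⟨i, by simp [hi], fun j hj => by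
        rcases Finset.mem_cons.1 hj with rfl | hj
        · exact hd
        · exact h j hj⟩

/-- Some vector of a unimodular basis divides twice all values of a form over a valuation ring. -/
lemma exists_basis_dvd [PreValuationRing R] {M : Matrix (Fin 3) (Fin 3) R} (hM : M.IsSymm) :
    ∃ e f g : Fin 3 → R, det3 e f g = 1 ∧ ∀ x y, bil M e e ∣ 2 * bil M x y := by
  set b : Fin 3 → Fin 3 → R := fun i => Pi.single i 1 with hb
  -- The candidates are the `b k` and the `b k + b (k + 1)`. Their norms determine twice every
  -- matrix entry by polarisation, and in `Fin 3` any two distinct indices are cyclic neighbours.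
  set E : Fin 3 × Bool → Fin 3 → R := fun kb => b kb.1 + if kb.2 then b (kb.1 + 1) else 0 with hE
  obtain ⟨⟨k, t⟩, -, hk⟩ := exists_dvd_forall (Finset.univ : Finset (Fin 3 × Bool))
    Finset.univ_nonempty fun kb => bil M (E kb) (E kb)
  have hbM : ∀ i j, bil M (b i) (b j) = M i j := fun i j => by simp [bil, hb]
  set d := bil M (E (k, t)) (E (k, t)) with hd
  have h0 : ∀ i, d ∣ M i i := fun i => by
    have := hk (i, false) (Finset.mem_univ _)
    simpa [hE, hbM] using this
  have h1 : ∀ i, d ∣ 2 * M i (i + 1) := fun i => by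
    have h := hk (i, true) (Finset.mem_univ _)
    simp only [hE, if_true, bil_add_left, bil_add_right, hbM] at h
    have e : 2 * M i (i + 1) = (M i i + M (i + 1) i + (M i (i + 1) + M (i + 1) (i + 1)))
        - M i i - M (i + 1) (i + 1) := by rw [hM.apply i (i + 1)]; ring
    rw [e]
    exact dvd_sub (dvd_sub (by simpa [hE, bil_add_left, bil_add_right, hbM] using h) (h0 _)) (h0 _)
  have h2 : ∀ i j, d ∣ 2 * M i j := fun i j => by
    have hij : j = i ∨ j = i + 1 ∨ i = j + 1 := by fin_cases i <;> fin_cases j <;> decide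
    rcases hij with rfl | rfl | rfl
    · exact (h0 _).mul_left _
    · exact h1 _
    · rw [hM.apply]; exact h1 _
  refine ⟨E (k, t), b (k + 1), b (k + 2), ?_, fun x y => ?_⟩
  · fin_cases k <;> cases t <;> simp [det3, hE, hb]
  · have e : 2 * bil M x y = ∑ i, ∑ j, x i * y j * (2 * M i j) := by
      rw [bil_eq]; simp only [Fin.sum_univ_three]; ring
    rw [e]
    exact Finset.dvd_sum fun i _ => Finset.dvd_sum fun j _ => (h2 i j).mul_left _

/-- Symmetric bilinear forms over a valuation ring are diagonal on a sublattice of index `8`. -/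
lemma exists_orthogonal_basis [PreValuationRing R] {M : Matrix (Fin 3) (Fin 3) R}
    (hM : M.IsSymm) :
    ∃ u v w : Fin 3 → R, det3 u v w = 8 ∧ bil M u v = 0 ∧ bil M u w = 0 ∧ bil M v w = 0 ∧
      bil M u u ∣ bil M w w ∧ bil M v v ∣ bil M w w := by
  obtain ⟨e, f, g, hdet, hdvd⟩ := exists_basis_dvd hM
  obtain ⟨r, hr⟩ := hdvd e f
  obtain ⟨s, hs⟩ := hdvd e g
  have key : ∀ e f g : Fin 3 → R, det3 e f g = 4 → bil M e f = 0 → bil M e g = 0 →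
      bil M f f ∣ 2 * bil M f g → ∃ u v w : Fin 3 → R, det3 u v w = 8 ∧ bil M u v = 0 ∧
        bil M u w = 0 ∧ bil M v w = 0 := by
    rintro e f g h1 h2 h3 ⟨t, ht⟩
    refine ⟨e, f, (2 : R) • g + (-t) • f, ?_, h2, ?_, ?_⟩
    · have : det3 e f ((2 : R) • g + (-t) • f) = 2 * det3 e f g := by simp [det3]; ring
      rw [this, h1]; norm_num
    · rw [bil_add_right, bil_smul_right, bil_smul_right, h2, h3]; ring
    · rw [bil_add_right, bil_smul_right, bil_smul_right, ht]; ring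
  have h1 : ∃ u v w : Fin 3 → R, det3 u v w = 8 ∧ bil M u v = 0 ∧
        bil M u w = 0 ∧ bil M v w = 0 := by
    -- Gram–Schmidt: only `2 * bil M e f` is known to be a multiple of `bil M e e`, so `f` and `g`
    -- are doubled first. This costs 4 in the determinant, and the second stage costs another 2.
    set f' := (2 : R) • f + (-r) • e with hf'
    set g' := (2 : R) • g + (-s) • e with hg'
    have d4 : det3 e f' g' = 4 := by
      have : det3 e f' g' = 4 * det3 e f g := by simp [det3, hf', hg']; ring
      rw [this, hdet, mul_one]
    have o1 : bil M e f' = 0 := by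
      rw [hf', bil_add_right, bil_smul_right, bil_smul_right, hr]; ring
    have o2 : bil M e g' = 0 := by
      rw [hg', bil_add_right, bil_smul_right, bil_smul_right, hs]; ring
    clear_value f' g'
    obtain ⟨i, -, hi⟩ := exists_dvd_forall (Finset.univ : Finset (Fin 3)) Finset.univ_nonempty
      ![bil M f' f', bil M g' g', bil M (f' + g') (f' + g')]
    have hi0 := hi 0 (Finset.mem_univ _)
    have hi1 := hi 1 (Finset.mem_univ _)
    have hi2 := hi 2 (Finset.mem_univ _)
    have ex : bil M (f' + g') (f' + g') = bil M f' f' + 2 * bil M f' g' + bil M g' g' := by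
      rw [bil_add_left, bil_add_right, bil_add_right, bil_comm hM g' f']; ring
    have e2 : 2 * bil M f' g' = bil M (f' + g') (f' + g') - bil M f' f' - bil M g' g' := by
      rw [ex]; ring
    fin_cases i
    · refine key e f' g' d4 o1 o2 ?_
      rw [e2]; exact dvd_sub (dvd_sub hi2 hi0) hi1
    · refine key e g' (-f') ?_ o2 ?_ ?_
      · rw [← d4]; simp [det3]; ring
      · rw [← neg_one_smul R, bil_smul_right, o1, mul_zero]
      · rw [← neg_one_smul R, bil_smul_right, bil_comm hM g' f', mul_left_comm, e2]
        exact (dvd_sub (dvd_sub hi2 hi0) hi1).mul_left _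
    · refine key e (f' + g') g' ?_ ?_ o2 ?_
      · rw [← d4]; simp [det3]; ring
      · rw [bil_add_right, o1, o2, add_zero]
      · have : 2 * bil M (f' + g') g' = bil M (f' + g') (f' + g') - bil M f' f' + bil M g' g' := by
          rw [ex, bil_add_left]; ring
        rw [this]; exact dvd_add (dvd_sub hi2 hi0) hi1
  obtain ⟨u, v, w, h0, huv, huw, hvw⟩ := h1
  have hcyc : ∀ u v w : Fin 3 → R, det3 v w u = det3 u v w := fun u v w => by
    simp only [det3]; ring
  -- A cyclic permutation, which keeps the determinant, suffices to put the most divisible norm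
  -- last.
  have step : ∀ a b c : R, (a ∣ c ∧ b ∣ c) ∨ (b ∣ a ∧ c ∣ a) ∨ (c ∣ b ∧ a ∣ b) := fun a b c => by
    rcases ValuationRing.dvd_total a b with h | h <;> rcases ValuationRing.dvd_total b c with h' | h'
    · exact Or.inl ⟨h.trans h', h'⟩
    · exact Or.inr (Or.inr ⟨h', h⟩)
    · rcases ValuationRing.dvd_total a c with h'' | h''
      · exact Or.inl ⟨h'', h'⟩
      · exact Or.inr (Or.inl ⟨h, h''⟩)
    · exact Or.inr (Or.inl ⟨h, h'.trans h⟩)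
  rcases step (bil M u u) (bil M v v) (bil M w w) with h | h | h
  · exact ⟨u, v, w, h0, huv, huw, hvw, h⟩
  · exact ⟨v, w, u, by rw [hcyc, h0], hvw, by rw [bil_comm hM, huv], by rw [bil_comm hM, huw], h⟩
  · exact ⟨w, u, v, by rw [hcyc, hcyc, h0], by rw [bil_comm hM, huw], by rw [bil_comm hM, hvw],
      huv, h⟩

lemma cramer_det3 (u v w y : Fin 3 → R) :
    det3 u v w • y = det3 y v w • u + det3 u y w • v + det3 u v y • w := by
  ext i; fin_cases i <;> simp [det3] <;> ring

lemma bil_of_orthogonal {M : Matrix (Fin 3) (Fin 3) R} (hM : M.IsSymm) {u v w : Fin 3 → R}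
    (huv : bil M u v = 0) (huw : bil M u w = 0) (hvw : bil M v w = 0) (y z : Fin 3 → R) :
    det3 u v w ^ 2 * bil M y z = bil M u u * (det3 y v w * det3 z v w)
      + bil M v v * (det3 u y w * det3 u z w) + bil M w w * (det3 u v y * det3 u v z) := by
  have h : det3 u v w ^ 2 * bil M y z = bil M (det3 u v w • y) (det3 u v w • z) := by
    rw [bil_smul_left, bil_smul_right]; ring
  rw [h, cramer_det3 u v w y, cramer_det3 u v w z]
  simp only [bil_add_left, bil_add_right, bil_smul_left, bil_smul_right, huv, huw, hvw,
    bil_comm hM v u, bil_comm hM w u, bil_comm hM w v]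
  ring

/-- The adjugate is computed from that of the diagonal Gram matrix. It links the diagonal entries
with the `2 × 2` minors, and so with `D_Q`. -/
lemma adjugate_of_orthogonal {M : Matrix (Fin 3) (Fin 3) R} (hM : M.IsSymm)
    {u v w : Fin 3 → R} (huv : bil M u v = 0) (huw : bil M u w = 0) (hvw : bil M v w = 0)
    (i j : Fin 3) :
    det3 u v w ^ 2 * M.adjugate i j = bil M v v * bil M w w * (u i * u j)
      + bil M u u * bil M w w * (v i * v j) + bil M u u * bil M v v * (w i * w j) := by
  set P := of ![u, v, w] with hP
  have hdiag : P * M * Pᵀ = diagonal ![bil M u u, bil M v v, bil M w w] := by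
    have hG : ∀ i j, (P * M * Pᵀ) i j = bil M (![u, v, w] i) (![u, v, w] j) := fun i j => by
      rw [Matrix.mul_assoc]
      simp [hP, bil, mul_apply, dotProduct, mulVec]
    ext i j
    rw [hG]
    fin_cases i <;> fin_cases j <;>
      simp [huv, huw, hvw, bil_comm hM v u, bil_comm hM w u, bil_comm hM w v]
  have h1 : Pᵀ * adjugate (P * M * Pᵀ) * P = det3 u v w ^ 2 • M.adjugate := by
    rw [adjugate_mul_distrib, adjugate_mul_distrib]
    calc Pᵀ * (adjugate Pᵀ * (adjugate M * adjugate P)) * P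
        = (Pᵀ * adjugate Pᵀ) * adjugate M * (adjugate P * P) := by simp only [Matrix.mul_assoc]
      _ = _ := by
        rw [mul_adjugate, adjugate_mul, det_transpose, hP, ← det3_eq_det]
        simp [pow_two, smul_smul]
  have h2 := congrFun (congrFun h1 i) j
  rw [Matrix.smul_apply, smul_eq_mul] at h2
  rw [← h2, hdiag, adjugate_diagonal]
  have c0 : (Finset.univ.erase (0 : Fin 3)) = {1, 2} := by decide
  have c1 : (Finset.univ.erase (1 : Fin 3)) = {0, 2} := by decide
  have c2 : (Finset.univ.erase (2 : Fin 3)) = {0, 1} := by decide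
  simp [mul_apply, Fin.sum_univ_three, hP, diagonal_apply, c0, c1, c2]
  ring

end Diagonalization

end TernaryForm

/-! ### Zeros of a diagonal form over `ℤ_p`, sorted into classes. -/

namespace TernaryForm

section Padic

variable {p : ℕ} [Fact p.Prime]

lemma padic_dvd_iff_valuation_le {x y : ℤ_[p]} (hx : x ≠ 0) (hy : y ≠ 0) :
    x ∣ y ↔ x.valuation ≤ y.valuation := by
  constructor
  · rintro ⟨c, rfl⟩
    rw [PadicInt.valuation_mul hx (right_ne_zero_of_mul hy)]; omega
  · intro h
    rw [PadicInt.unitCoeff_spec hx, PadicInt.unitCoeff_spec hy]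
    exact Units.mul_left_dvd.2 ((pow_dvd_pow _ h).mul_left _)

lemma padic_valuation_dvd {x : ℤ_[p]} {n : ℕ} (hx : x ≠ 0) :
    (p : ℤ_[p]) ^ n ∣ x ↔ n ≤ x.valuation := by
  rw [padic_dvd_iff_valuation_le (pow_ne_zero _ PadicInt.prime_p.ne_zero) hx,
    PadicInt.valuation_pow, PadicInt.valuation_p, mul_one]

lemma padic_exists_unit_mul {x y : ℤ_[p]} (hx : x ≠ 0) (hy : y ≠ 0)
    (h : x.valuation = y.valuation) : ∃ a : ℤ_[p], IsUnit a ∧ x = a * y := by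
  obtain ⟨u, hu⟩ := associated_of_dvd_dvd ((padic_dvd_iff_valuation_le hy hx).2 h.ge)
    ((padic_dvd_iff_valuation_le hx hy).2 h.le)
  exact ⟨u, u.isUnit, by rw [← hu, mul_comm]⟩

variable {A B C : ℤ_[p]} {Y : Type*} {x y z : Y → ℤ_[p]}

/-- Points near the singular point `(0, 0, 1)`: if `C` divides `D s²` and `D t²`, then `C²` divides
`(D s t)²`, and `ℤ_p` is integrally closed. The factor 4 is there only to match
`exists_sign_classes`. -/
lemma dvd_four_mul_of_dvd (hq : ∀ u, A * x u ^ 2 + B * y u ^ 2 + C * z u ^ 2 = 0)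
    {u v : Y} (hu : C ∣ A * x u ^ 2) (hv : C ∣ A * x v ^ 2) :
    C ∣ 4 * (A * (x u * x v) + B * (y u * y v)) := by
  have key : ∀ D s t : ℤ_[p], C ∣ D * s ^ 2 → C ∣ D * t ^ 2 → C ∣ D * (s * t) := fun D s t h1 h2 => by
    rw [← IsIntegrallyClosed.pow_dvd_pow_iff (n := 2) two_ne_zero]
    have := mul_dvd_mul h1 h2
    convert this using 1 <;> ring
  have hB : ∀ w, C ∣ A * x w ^ 2 → C ∣ B * y w ^ 2 := fun w h => by
    have e : B * y w ^ 2 = -(A * x w ^ 2) - C * z w ^ 2 := by linear_combination hq w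
    rw [e]; exact dvd_sub (dvd_neg.2 h) (dvd_mul_right _ _)
  exact (dvd_add (key _ _ _ hu hv) (key _ _ _ (hB u hu) (hB v hv))).mul_left _

/-- Away from the singular point, `A x²` and `B y²` must cancel modulo `C`, so they share a
valuation smaller than that of `C`. -/
lemma valuation_of_not_dvd (hA : A ≠ 0) (hB : B ≠ 0) (hC : C ≠ 0)
    (hq : ∀ u, A * x u ^ 2 + B * y u ^ 2 + C * z u ^ 2 = 0) {u : Y}
    (hu : ¬ C ∣ A * x u ^ 2) :
    x u ≠ 0 ∧ y u ≠ 0 ∧ A * x u ^ 2 ∣ C ∧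
      A.valuation + 2 * (x u).valuation = B.valuation + 2 * (y u).valuation ∧
      B.valuation + 2 * (y u).valuation < C.valuation := by
  have hx : x u ≠ 0 := fun h => hu (by rw [h]; simp)
  have hE : A * x u ^ 2 ≠ 0 := mul_ne_zero hA (pow_ne_zero _ hx)
  have e : B * y u ^ 2 = -(A * x u ^ 2) - C * z u ^ 2 := by linear_combination hq u
  have e' : A * x u ^ 2 = -(B * y u ^ 2) - C * z u ^ 2 := by linear_combination hq u
  have hF' : ¬ C ∣ B * y u ^ 2 := fun h => hu (by
    rw [e']; exact dvd_sub (dvd_neg.2 h) (dvd_mul_right _ _))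
  have hy : y u ≠ 0 := fun h => hF' (by rw [h]; simp)
  have hF : B * y u ^ 2 ≠ 0 := mul_ne_zero hB (pow_ne_zero _ hy)
  have h1 : A * x u ^ 2 ∣ C := (ValuationRing.dvd_total _ _).resolve_right hu
  have h2 : B * y u ^ 2 ∣ C := (ValuationRing.dvd_total _ _).resolve_right hF'
  have h3 : A * x u ^ 2 ∣ B * y u ^ 2 := by
    rw [e]; exact dvd_sub (dvd_neg.2 dvd_rfl) (h1.mul_right _)
  have h4 : B * y u ^ 2 ∣ A * x u ^ 2 := by
    rw [e']; exact dvd_sub (dvd_neg.2 dvd_rfl) (h2.mul_right _)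
  rw [padic_dvd_iff_valuation_le hE hF] at h3
  rw [padic_dvd_iff_valuation_le hF hE] at h4
  rw [padic_dvd_iff_valuation_le hC hF] at hF'
  rw [PadicInt.valuation_mul hB (pow_ne_zero _ hy), PadicInt.valuation_pow] at h3 h4 hF'
  rw [PadicInt.valuation_mul hA (pow_ne_zero _ hx), PadicInt.valuation_pow] at h3 h4
  exact ⟨hx, hy, h1, by omega, by omega⟩

/-- Relative to a reference zero `w`, write `x u = a * x w` and `y u = b * y w`. Then `G = C / (A
x_w²)` divides `(a - b)(a + b)`. As `a` is a unit, the two factors share at most a divisor of 2, so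
`b` is `a` or `-a` modulo `G` up to that 2. The Boolean records which. -/
lemma exists_sign_classes (hA : A ≠ 0) (hB : B ≠ 0) (hC : C ≠ 0)
    (hq : ∀ u, A * x u ^ 2 + B * y u ^ 2 + C * z u ^ 2 = 0) (n : ℕ) :
    ∃ s : Y → Bool, ∀ u v, ¬ C ∣ A * x u ^ 2 → ¬ C ∣ A * x v ^ 2 → (y u).valuation = n →
      (y v).valuation = n → s u = s v → C ∣ 4 * (A * (x u * x v) + B * (y u * y v)) := by
  classical
  by_cases hne : ∃ w, ¬ C ∣ A * x w ^ 2 ∧ (y w).valuation = n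
  swap
  · exact ⟨fun _ => true, fun u v hu _ hn _ _ => absurd ⟨u, hu, hn⟩ hne⟩
  obtain ⟨w, hw, hwn⟩ := hne
  obtain ⟨hxw, hyw, ⟨G, hG⟩, hvw, -⟩ := valuation_of_not_dvd hA hB hC hq hw
  have hE : A * x w ^ 2 ≠ 0 := mul_ne_zero hA (pow_ne_zero _ hxw)
  have hab : ∀ u, ∃ ab : ℤ_[p] × ℤ_[p], ¬ C ∣ A * x u ^ 2 → (y u).valuation = n →
      IsUnit ab.1 ∧ x u = ab.1 * x w ∧ y u = ab.2 * y w := fun u => by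
    by_cases hu : ¬ C ∣ A * x u ^ 2 ∧ (y u).valuation = n
    · obtain ⟨hxu, hyu, -, hvu, -⟩ := valuation_of_not_dvd hA hB hC hq hu.1
      obtain ⟨a, ha, hxa⟩ := padic_exists_unit_mul hxu hxw (by omega)
      obtain ⟨b, -, hyb⟩ := padic_exists_unit_mul hyu hyw (by omega)
      exact ⟨(a, b), fun _ _ => ⟨ha, hxa, hyb⟩⟩
    · exact ⟨0, fun h1 h2 => absurd ⟨h1, h2⟩ hu⟩
  choose ab hab using hab
  have hsign : ∀ u, ¬ C ∣ A * x u ^ 2 → (y u).valuation = n →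
      G ∣ 2 * ((ab u).1 - (ab u).2) ∨ G ∣ 2 * ((ab u).1 + (ab u).2) := fun u hu hn => by
    obtain ⟨ha, hxa, hyb⟩ := hab u hu hn
    set a := (ab u).1
    set b := (ab u).2
    have h1 : G ∣ (a - b) * (a + b) := by
      rw [← mul_dvd_mul_iff_left hE, ← hG]
      have e : A * x w ^ 2 * ((a - b) * (a + b)) = C * (b ^ 2 * z w ^ 2 - z u ^ 2) := by
        have h1 := hq u
        rw [hxa, hyb] at h1
        linear_combination h1 - b ^ 2 * hq w
      rw [e]; exact dvd_mul_right _ _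
    rcases ValuationRing.dvd_total (a - b) (a + b) with h | h
    · right
      have h2 : a - b ∣ 2 := by
        rw [← ha.dvd_mul_right (b := 2) (u := a)]
        have : 2 * a = (a + b) + (a - b) := by ring
        rw [this]; exact dvd_add h dvd_rfl
      exact h1.trans (mul_dvd_mul_right h2 _)
    · left
      have h2 : a + b ∣ 2 := by
        rw [← ha.dvd_mul_right (b := 2) (u := a)]
        have : 2 * a = (a + b) + (a - b) := by ring
        rw [this]; exact dvd_add dvd_rfl h
      rw [mul_comm] at h1
      exact h1.trans (mul_dvd_mul_right h2 _)
  refine ⟨fun u => decide (G ∣ 2 * ((ab u).1 - (ab u).2)), fun u v hu hv hnu hnv hs => ?_⟩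
  have hsu := hsign u hu hnu
  have hsv := hsign v hv hnv
  obtain ⟨-, hxa, hyb⟩ := hab u hu hnu
  obtain ⟨-, hxa', hyb'⟩ := hab v hv hnv
  have hs' : G ∣ 2 * ((ab u).1 - (ab u).2) ↔ G ∣ 2 * ((ab v).1 - (ab v).2) := by simpa using hs
  set a := (ab u).1
  set b := (ab u).2
  set a' := (ab v).1
  set b' := (ab v).2
  have key : G ∣ 4 * (a * a' - b * b') := by
    by_cases h : G ∣ 2 * (a - b)
    · have e : 4 * (a * a' - b * b') = 2 * (a - b) * (2 * a') + 2 * (a' - b') * (2 * b) := by ring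
      rw [e]; exact dvd_add (h.mul_right _) ((hs'.1 h).mul_right _)
    · have h1 := hsu.resolve_left h
      have h2 := hsv.resolve_left fun h' => h (hs'.2 h')
      have e : 4 * (a * a' - b * b') = 2 * (a + b) * (2 * a') - 2 * (a' + b') * (2 * b) := by ring
      rw [e]; exact dvd_sub (h1.mul_right _) (h2.mul_right _)
  -- Modulo `C`, `B y_w²` may be replaced by `-A x_w²`, so the bilinear form becomes `A x_w² (a a' -
  -- b b')`.
  have e : 4 * (A * (x u * x v) + B * (y u * y v))
      = A * x w ^ 2 * (4 * (a * a' - b * b')) - C * (4 * z w ^ 2 * (b * b')) := by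
    rw [hxa, hyb, hxa', hyb']
    linear_combination 4 * b * b' * hq w
  rw [e]
  refine dvd_sub ?_ (dvd_mul_right _ _)
  conv_lhs => rw [hG]
  exact mul_dvd_mul_left _ key

/-- The zeros of a diagonal form over `ℤ_p` fall into few classes on which the associated bilinear
form is highly divisible. -/
lemma exists_padic_classes (hA : A ≠ 0) (hB : B ≠ 0) (hC : C ≠ 0)
    (hq : ∀ u, A * x u ^ 2 + B * y u ^ 2 + C * z u ^ 2 = 0) :
    ∃ c : Y → ℕ, (∀ u v, c u = c v → C ∣ 4 * (A * (x u * x v) + B * (y u * y v))) ∧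
      (∀ u, ¬ C ∣ A * x u ^ 2 → c u < 2 * ((C.valuation - B.valuation + 1) / 2)) ∧
      ∀ u, C ∣ A * x u ^ 2 → c u = 2 * ((C.valuation - B.valuation + 1) / 2) := by
  classical
  choose s hs using exists_sign_classes hA hB hC hq
  -- The label encodes the valuation of `y` and a sign bit. That valuation is less than half of
  -- `v(C) - v(B)`, rounded up, so the singular class can take the next free label.
  refine ⟨fun u => if C ∣ A * x u ^ 2 then 2 * ((C.valuation - B.valuation + 1) / 2)
    else 2 * (y u).valuation + (s (y u).valuation u).toNat, fun u v h => ?_, fun u hu => ?_,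
    fun u hu => by simp [hu]⟩
  · by_cases hu : C ∣ A * x u ^ 2 <;> by_cases hv : C ∣ A * x v ^ 2
    · exact dvd_four_mul_of_dvd hq hu hv
    · exfalso
      have := (valuation_of_not_dvd hA hB hC hq hv).2.2.2.2
      have := Bool.toNat_le (s (y v).valuation v)
      simp only [hu, hv, if_true, if_false] at h
      omega
    · exfalso
      have := (valuation_of_not_dvd hA hB hC hq hu).2.2.2.2
      have := Bool.toNat_le (s (y u).valuation u)
      simp only [hu, hv, if_true, if_false] at h
      omega
    · simp only [hu, hv, if_false] at h
      have h1 := Bool.toNat_le (s (y v).valuation v)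
      have h2 := Bool.toNat_le (s (y u).valuation u)
      have h3 : (y u).valuation = (y v).valuation := by omega
      rw [h3] at h
      refine hs (y v).valuation u v hu hv h3 rfl ?_
      have h4 : (s (y v).valuation u).toNat = (s (y v).valuation v).toNat := by omega
      revert h4
      cases s (y v).valuation u <;> cases s (y v).valuation v <;> simp
  · have := (valuation_of_not_dvd hA hB hC hq hu).2.2.2.2
    have := Bool.toNat_le (s (y u).valuation u)
    simp only [hu, if_false]
    omega

end Padic

end TernaryForm

/-! ### The associated matrix, its minors, and zeros modulo a prime. -/

namespace TernaryForm

open MvPolynomial Matrix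

lemma bil_map {R S : Type*} [CommRing R] [CommRing S] (f : R →+* S)
    (M : Matrix (Fin 3) (Fin 3) R) (u v : Fin 3 → R) :
    bil (M.map f) (fun i => f (u i)) (fun i => f (v i)) = f (bil M u v) := by
  simp [bil_eq]

lemma det3_map {R S : Type*} [CommRing R] [CommRing S] (f : R →+* S) (u v w : Fin 3 → R) :
    det3 (fun i => f (u i)) (fun i => f (v i)) (fun i => f (w i)) = f (det3 u v w) := by
  simp [det3]

lemma assocMatrix_isSymm (Q : MvPolynomial (Fin 3) ℤ) : (assocMatrix Q).IsSymm := by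
  ext i j
  simp only [assocMatrix, transpose_apply, of_apply]
  -- The commutator of two derivations is a derivation, so it is enough that it kills the variables.
  have h : ⁅(pderiv j : Derivation ℤ (MvPolynomial (Fin 3) ℤ) (MvPolynomial (Fin 3) ℤ)),
      (pderiv i : Derivation ℤ (MvPolynomial (Fin 3) ℤ) (MvPolynomial (Fin 3) ℤ))⁆ = 0 := by
    refine derivation_ext fun k => ?_
    rw [Derivation.commutator_apply, pderiv_X, pderiv_X]
    simp [Pi.single_apply, apply_ite]
  have h' := DFunLike.congr_fun h Q
  rw [Derivation.commutator_apply] at h'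
  exact congrArg _ (sub_eq_zero.1 h')

/-- Euler's identity, applied to `Q` and then to its linear partial derivatives. -/
lemma two_mul_aeval {Q : MvPolynomial (Fin 3) ℤ} (hQ : Q.IsHomogeneous 2) {R : Type*}
    [CommRing R] (y : Fin 3 → R) :
    2 * aeval y Q = bil ((assocMatrix Q).map (Int.castRingHom R)) y y := by
  have h1 := congrArg (aeval y) hQ.sum_X_mul_pderiv
  have h2 : ∀ i, aeval y (pderiv i Q) = ∑ j, y j * (assocMatrix Q j i : R) := fun i => by
    have hi : (pderiv i Q).IsHomogeneous 1 := hQ.pderiv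
    have h3 := congrArg (aeval y) hi.sum_X_mul_pderiv
    rw [one_smul] at h3
    rw [← h3, map_sum]
    refine Finset.sum_congr rfl fun j _ => ?_
    have h4 : (pderiv j (pderiv i Q)).IsHomogeneous 0 := hi.pderiv
    rw [← totalDegree_zero_iff_isHomogeneous, totalDegree_eq_zero_iff_eq_C] at h4
    rw [map_mul, aeval_X, h4]
    simp [assocMatrix, constantCoeff_eq]
  rw [map_sum, map_nsmul] at h1
  simp only [map_mul, aeval_X, h2, nsmul_eq_mul, Nat.cast_ofNat] at h1
  rw [← h1, bil_eq, (assocMatrix_isSymm Q).map _ |>.apply 0 1,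
    (assocMatrix_isSymm Q).map _ |>.apply 0 2, (assocMatrix_isSymm Q).map _ |>.apply 1 2]
  simp only [Fin.sum_univ_three, map_apply, eq_intCast]
  rw [(assocMatrix_isSymm Q).apply 0 1, (assocMatrix_isSymm Q).apply 0 2,
    (assocMatrix_isSymm Q).apply 1 2]
  ring

lemma bil_eq_zero_of_eval {Q : MvPolynomial (Fin 3) ℤ} (hQ : Q.IsHomogeneous 2)
    {y : Fin 3 → ℤ} (hy : eval y Q = 0) : bil (assocMatrix Q) y y = 0 := by
  have := two_mul_aeval hQ y
  rw [aeval_eq_eval, hy, mul_zero] at this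
  exact this.symm

lemma adjugate_associated_minor {R : Type*} [CommRing R] (M : Matrix (Fin 3) (Fin 3) R)
    (i j : Fin 3) :
    Associated (M.adjugate i j) (M.submatrix j.succAbove i.succAbove).det := by
  rw [adjugate_fin_succ_eq_det_submatrix]
  rcases neg_one_pow_eq_or R (j + i : ℕ) with h | h <;> rw [h]
  · rw [one_mul]
  · rw [neg_one_mul]; exact (Associated.refl _).neg_left

lemma minorGcd_dvd_adjugate (Q : MvPolynomial (Fin 3) ℤ) (i j : Fin 3) :
    (minorGcd Q : ℤ) ∣ (assocMatrix Q).adjugate i j := by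
  rw [(adjugate_associated_minor _ i j).dvd_iff_dvd_right, Int.natCast_dvd]
  generalize hm : ((assocMatrix Q).submatrix j.succAbove i.succAbove).det.natAbs = m
  have h : minorGcd Q ∣ (fun ij : Fin 3 × Fin 3 =>
      ((assocMatrix Q).submatrix ij.1.succAbove ij.2.succAbove).det.natAbs) (j, i) :=
    Finset.gcd_dvd (Finset.mem_univ _)
  rw [← hm]
  exact h

lemma dvd_mul_minorGcd {Q : MvPolynomial (Fin 3) ℤ} {k m : ℕ}
    (h : ∀ i j, (k : ℤ) ∣ m * (assocMatrix Q).adjugate i j) : k ∣ m * minorGcd Q := by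
  have h2 := Finset.gcd_mul_left (s := (Finset.univ : Finset (Fin 3 × Fin 3)))
    (f := fun ij : Fin 3 × Fin 3 =>
      ((assocMatrix Q).submatrix ij.1.succAbove ij.2.succAbove).det.natAbs) (a := m)
  rw [normalize_eq] at h2
  rw [minorGcd, ← h2]
  refine Finset.dvd_gcd fun ij _ => ?_
  have := h ij.2 ij.1
  rw [((adjugate_associated_minor _ ij.2 ij.1).mul_left _).dvd_iff_dvd_right, Int.natCast_dvd,
    Int.natAbs_mul, Int.natAbs_natCast] at this
  exact this

lemma minorGcd_ne_zero {Q : MvPolynomial (Fin 3) ℤ} (hΔ : discr Q ≠ 0) : minorGcd Q ≠ 0 := by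
  intro h
  have h1 : (assocMatrix Q).adjugate = 0 := by
    ext i j
    have := minorGcd_dvd_adjugate Q i j
    rw [h] at this
    simpa using this
  have h2 := mul_adjugate (assocMatrix Q)
  rw [h1, Matrix.mul_zero] at h2
  have h3 := congrFun (congrFun h2 0) 0
  simp at h3
  exact hΔ h3.symm

/-- Counting the zeros of `a x² + b y²` in the plane over a finite field. -/
lemma card_binary_zeros {p : ℕ} [Fact p.Prime] (hp : p ≠ 2) {a b : ZMod p} (ha : a ≠ 0) :
    (((Finset.univ : Finset (ZMod p × ZMod p)).filter
      fun t => a * t.2 ^ 2 + b * t.1 ^ 2 = 0).card : ℤ)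
      = 1 + (p - 1) * (1 + quadraticChar (ZMod p) (-(a * b))) := by
  have hchar : ringChar (ZMod p) ≠ 2 := by rwa [ZMod.ringChar_zmod_n]
  have h1 : ∀ y : ZMod p, (((Finset.univ : Finset (ZMod p)).filter
      fun x => a * x ^ 2 + b * y ^ 2 = 0).card : ℤ)
        = if y = 0 then 1 else 1 + quadraticChar (ZMod p) (-(a * b)) := fun y => by
    have e : ((Finset.univ : Finset (ZMod p)).filter fun x => a * x ^ 2 + b * y ^ 2 = 0)
        = {x : ZMod p | x ^ 2 = -(a * b) * (y / a) ^ 2}.toFinset := by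
      ext x
      simp only [Finset.mem_filter, Finset.mem_univ, true_and, Set.mem_toFinset, Set.mem_ofPred_eq]
      field_simp
      constructor <;> intro h
      · linear_combination h
      · linear_combination h
    rw [e, quadraticChar_card_sqrts hchar]
    split_ifs with h
    · simp [h]
    · have : y / a ≠ 0 := div_ne_zero h ha
      rw [map_mul, map_pow, quadraticChar_sq_one this, mul_one, add_comm]
  have h2 : ((Finset.univ : Finset (ZMod p × ZMod p)).filter
      fun t => a * t.2 ^ 2 + b * t.1 ^ 2 = 0).card
      = ∑ y : ZMod p, ((Finset.univ : Finset (ZMod p)).filter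
      fun x => a * x ^ 2 + b * y ^ 2 = 0).card := by
    rw [Finset.card_filter, ← Finset.univ_product_univ, Finset.sum_product]
    simp only [Finset.card_filter]
  rw [h2]
  push_cast
  simp only [h1]
  rw [← Finset.add_sum_erase _ _ (Finset.mem_univ (0 : ZMod p)), if_pos rfl,
    Finset.sum_congr rfl fun y hy => if_neg (Finset.ne_of_mem_erase hy), Finset.sum_const,
    Finset.card_erase_of_mem (Finset.mem_univ _), Finset.card_univ, ZMod.card, nsmul_eq_mul,
    Nat.cast_sub (Fact.out : p.Prime).one_lt.le]
  norm_num

/-- The number of zeros modulo `p` of a form that is diagonal with corank one modulo `p`. -/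
lemma zerosMod_eq {Q : MvPolynomial (Fin 3) ℤ} (hQ : Q.IsHomogeneous 2) {p : ℕ} [Fact p.Prime]
    (hp : p ≠ 2) {u v w : Fin 3 → ZMod p} (hd : det3 u v w ≠ 0)
    (huv : bil ((assocMatrix Q).map (Int.castRingHom (ZMod p))) u v = 0)
    (huw : bil ((assocMatrix Q).map (Int.castRingHom (ZMod p))) u w = 0)
    (hvw : bil ((assocMatrix Q).map (Int.castRingHom (ZMod p))) v w = 0)
    (hww : bil ((assocMatrix Q).map (Int.castRingHom (ZMod p))) w w = 0) {a b : ZMod p}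
    (hu : bil ((assocMatrix Q).map (Int.castRingHom (ZMod p))) u u = a)
    (hv : bil ((assocMatrix Q).map (Int.castRingHom (ZMod p))) v v = b)
    (ha : a ≠ 0) :
    (zerosMod Q p : ℤ) = p * (p - 1) * (1 + quadraticChar (ZMod p) (-(a * b))) + p - 1 := by
  set N := (assocMatrix Q).map (Int.castRingHom (ZMod p)) with hN
  have hNs : N.IsSymm := (assocMatrix_isSymm Q).map _
  have h2 : (2 : ZMod p) ≠ 0 := by
    have : ringChar (ZMod p) ≠ 2 := by rwa [ZMod.ringChar_zmod_n]
    exact Ring.two_ne_zero this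
  set φ : ZMod p × (ZMod p × ZMod p) → Fin 3 → ZMod p :=
    fun t => t.2.2 • u + t.2.1 • v + t.1 • w with hφ
  have hinj : Function.Injective φ := by
    intro s t hst
    have e0 : ∀ t, det3 (φ t) v w = t.2.2 * det3 u v w := fun t => by simp [det3, hφ]; ring
    have e1 : ∀ t, det3 u (φ t) w = t.2.1 * det3 u v w := fun t => by simp [det3, hφ]; ring
    have e2 : ∀ t, det3 u v (φ t) = t.1 * det3 u v w := fun t => by simp [det3, hφ]; ring
    have f0 : s.2.2 = t.2.2 := mul_right_cancel₀ hd (by rw [← e0, ← e0, hst])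
    have f1 : s.2.1 = t.2.1 := mul_right_cancel₀ hd (by rw [← e1, ← e1, hst])
    have f2 : s.1 = t.1 := mul_right_cancel₀ hd (by rw [← e2, ← e2, hst])
    exact Prod.ext f2 (Prod.ext f1 f0)
  have hsurj : ∀ y, ∃ t, φ t = y := fun y => by
    refine ⟨((det3 u v w)⁻¹ * det3 u v y, (det3 u v w)⁻¹ * det3 u y w,
      (det3 u v w)⁻¹ * det3 y v w), ?_⟩
    have := cramer_det3 u v w y
    simp only [hφ, ← smul_smul, ← smul_add, ← this]
    rw [inv_smul_smul₀ hd]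
  have hzero : ∀ t, aeval (φ t) Q = 0 ↔ a * t.2.2 ^ 2 + b * t.2.1 ^ 2 = 0 := fun t => by
    have e : bil N (φ t) (φ t) = a * t.2.2 ^ 2 + b * t.2.1 ^ 2 := by
      simp only [hφ, bil_add_left, bil_add_right, bil_smul_left, bil_smul_right, huv, huw, hvw,
        bil_comm hNs v u, bil_comm hNs w u, bil_comm hNs w v, hww, hu, hv]
      ring
    rw [← e, ← two_mul_aeval hQ, mul_eq_zero, or_iff_right h2]
  have hall : {y : Fin 3 → ZMod p | aeval y Q = 0}.ncard
      = p * ((Finset.univ : Finset (ZMod p × ZMod p)).filter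
        fun t => a * t.2 ^ 2 + b * t.1 ^ 2 = 0).card := by
    have e : {y : Fin 3 → ZMod p | aeval y Q = 0} = φ '' (((Finset.univ : Finset (ZMod p)) ×ˢ
        ((Finset.univ : Finset (ZMod p × ZMod p)).filter
          fun t => a * t.2 ^ 2 + b * t.1 ^ 2 = 0) : Finset _) : Set _) := by
      ext y
      obtain ⟨t, rfl⟩ := hsurj y
      simp only [Set.mem_ofPred_eq, hzero, hinj.mem_set_image, Finset.coe_product,
        Finset.coe_univ, Set.mem_prod, Set.mem_univ, true_and, Finset.mem_coe, Finset.mem_filter,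
        Finset.mem_univ]
    rw [e, Set.ncard_image_of_injective _ hinj, Set.ncard_coe_finset, Finset.card_product,
      Finset.card_univ, ZMod.card]
  have h0 : (0 : Fin 3 → ZMod p) ∈ {y : Fin 3 → ZMod p | aeval y Q = 0} := by
    have h := (hzero 0).2 (by simp)
    have e : φ 0 = 0 := by simp [hφ]
    rwa [e] at h
  have hz : zerosMod Q p + 1 = {y : Fin 3 → ZMod p | aeval y Q = 0}.ncard := by
    rw [← Set.ncard_sdiff_singleton_add_one h0]
    have e : {y : Fin 3 → ZMod p | aeval y Q = 0} \ {0}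
        = {y : Fin 3 → ZMod p | y ≠ 0 ∧ aeval y Q = 0} := by
      ext y
      simp [and_comm]
    rw [e, zerosMod]
  have hcount := card_binary_zeros (b := b) hp ha
  have : (zerosMod Q p : ℤ) + 1 = p * (1 + (p - 1) * (1 + quadraticChar (ZMod p) (-(a * b)))) := by
    rw [← hcount]; exact_mod_cast hz.trans hall
  linear_combination this

end TernaryForm

/-! ### Orthogonal frames over `ℤ_p`, and the primes dividing `2 D_Q`. -/

namespace TernaryForm

open MvPolynomial Matrix

/-- The primitive integer zeros of `Q`. -/
abbrev PrimitiveZero (Q : MvPolynomial (Fin 3) ℤ) : Type :=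
  {y : Fin 3 → ℤ // Finset.univ.gcd y = 1 ∧ eval y Q = 0}

/-- The associated matrix over `ℤ_p`. -/
noncomputable abbrev padicMatrix (Q : MvPolynomial (Fin 3) ℤ) (p : ℕ) [Fact p.Prime] :
    Matrix (Fin 3) (Fin 3) ℤ_[p] :=
  (assocMatrix Q).map (Int.castRingHom ℤ_[p])

lemma padicMatrix_adjugate (Q : MvPolynomial (Fin 3) ℤ) (p : ℕ) [Fact p.Prime] (i j : Fin 3) :
    (padicMatrix Q p).adjugate i j = (((assocMatrix Q).adjugate i j : ℤ) : ℤ_[p]) := by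
  have h := RingHom.map_adjugate (Int.castRingHom ℤ_[p]) (assocMatrix Q)
  exact (congrFun (congrFun h i) j).symm

/-- An orthogonal frame of index `8` over `ℤ_p`, the last vector having the most divisible norm. -/
structure PadicFrame (Q : MvPolynomial (Fin 3) ℤ) (p : ℕ) [Fact p.Prime] where
  (u v w : Fin 3 → ℤ_[p])
  det_eq : det3 u v w = 8
  uv : bil (padicMatrix Q p) u v = 0
  uw : bil (padicMatrix Q p) u w = 0
  vw : bil (padicMatrix Q p) v w = 0
  dvd_u : bil (padicMatrix Q p) u u ∣ bil (padicMatrix Q p) w w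
  dvd_v : bil (padicMatrix Q p) v v ∣ bil (padicMatrix Q p) w w

lemma padicFrame_nonempty (Q : MvPolynomial (Fin 3) ℤ) (p : ℕ) [Fact p.Prime] :
    Nonempty (PadicFrame Q p) := by
  obtain ⟨u, v, w, h0, h1, h2, h3, h4, h5⟩ :=
    exists_orthogonal_basis (M := padicMatrix Q p) ((assocMatrix_isSymm Q).map _)
  exact ⟨⟨u, v, w, h0, h1, h2, h3, h4, h5⟩⟩

lemma padic_valuation_intCast {p : ℕ} [Fact p.Prime] {z : ℤ} (hz : z ≠ 0) :
    (z : ℤ_[p]).valuation = z.natAbs.factorization p := by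
  refine eq_of_forall_le_iff fun k => ?_
  rw [← padic_valuation_dvd (by exact_mod_cast hz), PadicInt.pow_p_dvd_int_iff,
    ← (Fact.out : p.Prime).pow_dvd_iff_le_factorization (Int.natAbs_ne_zero.2 hz),
    ← Int.natCast_dvd]
  push_cast
  rfl

section PadicUnits

variable {p : ℕ} [Fact p.Prime]

lemma padic_val_mul {x y : ℤ_[p]} (h : x * y ≠ 0) :
    (x * y).valuation = x.valuation + y.valuation :=
  PadicInt.valuation_mul (left_ne_zero_of_mul h) (right_ne_zero_of_mul h)

lemma padic_isUnit_two_pow (hp : p ≠ 2) (k : ℕ) : IsUnit ((2 : ℤ_[p]) ^ k) := by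
  refine IsUnit.pow k ?_
  rw [PadicInt.isUnit_iff]
  have h := PadicInt.norm_natCast_eq_one_iff (p := p) (n := 2)
  rw [Nat.cast_ofNat] at h
  exact h.2 ((Nat.coprime_primes Fact.out Nat.prime_two).2 hp)

end PadicUnits

namespace PadicFrame

variable {Q : MvPolynomial (Fin 3) ℤ} {p : ℕ} [Fact p.Prime] (F : PadicFrame Q p)

noncomputable def A : ℤ_[p] := bil (padicMatrix Q p) F.u F.u

noncomputable def B : ℤ_[p] := bil (padicMatrix Q p) F.v F.v

noncomputable def C : ℤ_[p] := bil (padicMatrix Q p) F.w F.w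

/-- The coordinates of `8 y` in the frame. -/
noncomputable def x (y : Fin 3 → ℤ) : ℤ_[p] := det3 (fun i => (y i : ℤ_[p])) F.v F.w

noncomputable def y (y : Fin 3 → ℤ) : ℤ_[p] := det3 F.u (fun i => (y i : ℤ_[p])) F.w

noncomputable def z (y : Fin 3 → ℤ) : ℤ_[p] := det3 F.u F.v (fun i => (y i : ℤ_[p]))

lemma mul_eq : F.A * F.B * F.C = 64 * (discr Q : ℤ_[p]) := by
  have h := gram_det (M := padicMatrix Q p) ((assocMatrix_isSymm Q).map _) F.u F.v F.w
  rw [F.det_eq, F.uv, F.uw, F.vw] at h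
  have hd : (padicMatrix Q p).det = (discr Q : ℤ_[p]) := by
    rw [discr, ← eq_intCast (Int.castRingHom ℤ_[p]), RingHom.map_det]; rfl
  rw [hd] at h
  simp only [A, B, C]
  linear_combination -h

lemma mul_bil (s t : Fin 3 → ℤ) :
    64 * ((bil (assocMatrix Q) s t : ℤ) : ℤ_[p])
      = F.A * (F.x s * F.x t) + F.B * (F.y s * F.y t) + F.C * (F.z s * F.z t) := by
  have h := bil_of_orthogonal (M := padicMatrix Q p) ((assocMatrix_isSymm Q).map _) F.uv F.uw F.vw
    (fun i => (s i : ℤ_[p])) (fun i => (t i : ℤ_[p]))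
  have hb := bil_map (Int.castRingHom ℤ_[p]) (assocMatrix Q) s t
  simp only [eq_intCast] at hb
  rw [hb, F.det_eq] at h
  simp only [A, B, C, x, y, z]
  rw [← h]
  norm_num

lemma zero_eq (hQ : Q.IsHomogeneous 2) (s : PrimitiveZero Q) :
    F.A * F.x s ^ 2 + F.B * F.y s ^ 2 + F.C * F.z s ^ 2 = 0 := by
  have h := F.mul_bil s s
  rw [bil_eq_zero_of_eval hQ s.2.2] at h
  push_cast at h
  linear_combination -h

lemma mul_adjugate (i j : Fin 3) :
    64 * (((assocMatrix Q).adjugate i j : ℤ) : ℤ_[p]) = F.B * F.C * (F.u i * F.u j)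
      + F.A * F.C * (F.v i * F.v j) + F.A * F.B * (F.w i * F.w j) := by
  have h := adjugate_of_orthogonal (M := padicMatrix Q p) ((assocMatrix_isSymm Q).map _)
    F.uv F.uw F.vw i j
  rw [F.det_eq, padicMatrix_adjugate] at h
  simp only [A, B, C]
  rw [← h]
  norm_num

lemma ne_zero (hΔ : discr Q ≠ 0) : F.A * F.B * F.C ≠ 0 := by
  rw [F.mul_eq]
  exact mul_ne_zero (by norm_num) (by exact_mod_cast hΔ)

/-- As `A` and `B` divide `C`, all three terms of `mul_adjugate` are multiples of `A B`. The passage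
to `D_Q`, a gcd of integers, goes through the power of `p` associated to `A B`. -/
lemma A_mul_B_dvd (hΔ : discr Q ≠ 0) : F.A * F.B ∣ 64 * ((minorGcd Q : ℕ) : ℤ_[p]) := by
  have h0 : F.A * F.B ≠ 0 := left_ne_zero_of_mul (F.ne_zero hΔ)
  have hAC : F.A ∣ F.C := F.dvd_u
  have hBC : F.B ∣ F.C := F.dvd_v
  have h1 : ∀ i j, F.A * F.B ∣ 64 * (((assocMatrix Q).adjugate i j : ℤ) : ℤ_[p]) := fun i j => by
    rw [F.mul_adjugate]
    refine dvd_add (dvd_add (Dvd.dvd.mul_right ?_ _) (Dvd.dvd.mul_right ?_ _)) (dvd_mul_right _ _)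
    · rw [mul_comm F.B]; exact mul_dvd_mul_right hAC _
    · exact mul_dvd_mul_left _ hBC
  have h2 := PadicInt.unitCoeff_spec h0
  set n := (F.A * F.B).valuation
  rw [h2, Units.mul_left_dvd]
  have h3 : p ^ n ∣ 64 * minorGcd Q := dvd_mul_minorGcd fun i j => by
    have h4 := h1 i j
    rw [h2, Units.mul_left_dvd] at h4
    have h5 := (PadicInt.pow_p_dvd_int_iff (p := p) n (64 * (assocMatrix Q).adjugate i j)).1
      (by push_cast; exact h4)
    exact_mod_cast h5
  have h6 := (PadicInt.pow_p_dvd_int_iff (p := p) n (64 * minorGcd Q)).2 (by exact_mod_cast h3)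
  exact_mod_cast h6

/-- `A B - bil(u, v)²` is the value of the adjugate form at the cross product `u × v`, hence a
combination of minors, all divisible by `p`. -/
lemma dvd_A_mul_B (hpD : p ∣ minorGcd Q) : (p : ℤ_[p]) ∣ F.A * F.B := by
  have h1 : (padicMatrix Q p).adjugate = (p : ℤ_[p]) • (of fun i j =>
      ((((assocMatrix Q).adjugate i j / p : ℤ)) : ℤ_[p])) := by
    ext1 i j
    have hd : (p : ℤ) ∣ (assocMatrix Q).adjugate i j :=
      (Int.natCast_dvd_natCast.2 hpD).trans (minorGcd_dvd_adjugate Q i j)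
    rw [padicMatrix_adjugate, Matrix.smul_apply, of_apply, smul_eq_mul]
    conv_lhs => rw [← Int.mul_ediv_cancel' hd]
    push_cast
    rfl
  set N := padicMatrix Q p with hN
  have hadj : ∀ i j, (p : ℤ_[p]) ∣ N.adjugate i j := fun i j => by
    rw [h1, Matrix.smul_apply, smul_eq_mul]; exact dvd_mul_right _ _
  have hs : N.IsSymm := (assocMatrix_isSymm Q).map _
  have e : F.A * F.B = F.A * F.B - bil N F.u F.v ^ 2 := by rw [F.uv]; ring
  set n : Fin 3 → ℤ_[p] := ![F.u 1 * F.v 2 - F.u 2 * F.v 1, F.u 2 * F.v 0 - F.u 0 * F.v 2,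
    F.u 0 * F.v 1 - F.u 1 * F.v 0] with hn
  have e2 : F.A * F.B - bil N F.u F.v ^ 2 = ∑ i, ∑ j, n i * n j * N.adjugate i j := by
    simp only [A, B, ← hN]
    rw [adjugate_fin_three]
    simp only [Fin.sum_univ_three, bil_eq, hn, of_apply, cons_val_zero, cons_val_one, cons_val,
      hs.apply 0 1, hs.apply 0 2, hs.apply 1 2]
    ring
  rw [e, e2]
  exact Finset.dvd_sum fun i _ => Finset.dvd_sum fun j _ => (hadj i j).mul_left _

/-- Congruences in the frame translate into divisibility of the integral bilinear form. -/
lemma dvd_bil (hΔ : discr Q ≠ 0) {s t : Fin 3 → ℤ}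
    (h : F.C ∣ 4 * (F.A * (F.x s * F.x t) + F.B * (F.y s * F.y t))) :
    (p : ℤ) ^ (discr Q).natAbs.factorization p ∣
      2 ^ 14 * minorGcd Q * bil (assocMatrix Q) s t := by
  have h1 : F.C ∣ 256 * ((bil (assocMatrix Q) s t : ℤ) : ℤ_[p]) := by
    have e : 256 * ((bil (assocMatrix Q) s t : ℤ) : ℤ_[p])
        = 4 * (F.A * (F.x s * F.x t) + F.B * (F.y s * F.y t))
          + F.C * (4 * (F.z s * F.z t)) := by linear_combination 4 * F.mul_bil s t
    rw [e]; exact dvd_add h (dvd_mul_right _ _)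
  -- The product of the two divisibilities reads `64 Δ ∣ 64 D * (256 b(s, t))`, and `64 * 256 = 2 ^
  -- 14`.
  have h2 := mul_dvd_mul (F.A_mul_B_dvd hΔ) h1
  rw [F.mul_eq] at h2
  rw [← PadicInt.pow_p_dvd_int_iff]
  have h3 : (p : ℤ_[p]) ^ (discr Q).natAbs.factorization p ∣ (discr Q : ℤ_[p]) := by
    rw [padic_valuation_dvd (by exact_mod_cast hΔ), padic_valuation_intCast hΔ]
  refine (h3.trans ((dvd_mul_left _ _).trans h2)).trans (dvd_of_eq ?_)
  push_cast
  ring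

lemma valuation_add (hΔ : discr Q ≠ 0) (hp : p ≠ 2) :
    F.A.valuation + F.B.valuation + F.C.valuation = (discr Q).natAbs.factorization p := by
  have h := F.ne_zero hΔ
  have h1 := F.mul_eq
  have h2 : (64 : ℤ_[p]) = 2 ^ 6 := by norm_num
  have h3 : ((64 : ℤ_[p])).valuation = 0 := by
    obtain ⟨u, hu⟩ := padic_isUnit_two_pow hp 6
    by_contra h0
    have h4 := (padic_valuation_dvd (p := p) (n := 1) (x := 64) (by norm_num)).2 (by omega)
    rw [h2, ← hu, pow_one] at h4
    exact PadicInt.p_nonunit (isUnit_of_dvd_unit h4 u.isUnit)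
  rw [← padic_valuation_intCast hΔ, ← padic_val_mul (left_ne_zero_of_mul h), ← padic_val_mul h, h1,
    padic_val_mul (by rw [← h1]; exact h), h3, zero_add]

lemma valuation_C_le (hΔ : discr Q ≠ 0) :
    F.C.valuation ≤ (discr Q).natAbs.factorization p + 6 * if p = 2 then 1 else 0 := by
  split_ifs with hp
  · subst hp
    have h := F.ne_zero hΔ
    have h1 : F.C ∣ 64 * (discr Q : ℤ_[2]) := by rw [← F.mul_eq]; exact dvd_mul_left _ _
    have h64 : (64 : ℤ_[2]) * discr Q ≠ 0 := by rw [← F.mul_eq]; exact h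
    rw [padic_dvd_iff_valuation_le (right_ne_zero_of_mul h) h64, padic_val_mul h64,
      padic_valuation_intCast hΔ] at h1
    have h2 : (64 : ℤ_[2]) = ((2 : ℕ) : ℤ_[2]) ^ 6 := by norm_num
    rw [h2, PadicInt.valuation_pow, PadicInt.valuation_p] at h1
    omega
  · have := F.valuation_add hΔ hp
    omega

lemma exists_classes (hQ : Q.IsHomogeneous 2) (hΔ : discr Q ≠ 0) :
    ∃ c : PrimitiveZero Q → ℕ, (∀ s t, c s = c t →
        (p : ℤ) ^ (discr Q).natAbs.factorization p ∣
          2 ^ 14 * minorGcd Q * bil (assocMatrix Q) s t) ∧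
      (∀ s : PrimitiveZero Q, ¬ F.C ∣ F.A * F.x s ^ 2 →
        c s < 2 * ((F.C.valuation - F.B.valuation + 1) / 2)) ∧
      ∀ s : PrimitiveZero Q, F.C ∣ F.A * F.x s ^ 2 →
        c s = 2 * ((F.C.valuation - F.B.valuation + 1) / 2) := by
  have h := F.ne_zero hΔ
  obtain ⟨c, h1, h2, h3⟩ := exists_padic_classes (Y := PrimitiveZero Q)
    (x := fun s => F.x s) (y := fun s => F.y s) (z := fun s => F.z s)
    (left_ne_zero_of_mul (left_ne_zero_of_mul h))
    (right_ne_zero_of_mul (left_ne_zero_of_mul h)) (right_ne_zero_of_mul h) (F.zero_eq hQ)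
  exact ⟨c, fun s t hst => F.dvd_bil hΔ (h1 s t hst), h2, h3⟩

end PadicFrame

/-- Local classes at a bad prime. -/
lemma exists_classes_of_dvd {Q : MvPolynomial (Fin 3) ℤ} (hQ : Q.IsHomogeneous 2)
    (hΔ : discr Q ≠ 0) {p : ℕ} [Fact p.Prime] (hp : p ∣ 2 * minorGcd Q) :
    ∃ c : PrimitiveZero Q → ℕ, (∀ s t, c s = c t →
        (p : ℤ) ^ (discr Q).natAbs.factorization p ∣
          2 ^ 14 * minorGcd Q * bil (assocMatrix Q) s t) ∧
      ∀ s, c s < ((discr Q).natAbs.factorization p + 1) * if p = 2 then 8 else 1 := by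
  obtain ⟨F⟩ := padicFrame_nonempty Q p
  obtain ⟨c, h1, h2, h3⟩ := F.exists_classes hQ hΔ
  refine ⟨c, h1, fun s => ?_⟩
  have hc : c s ≤ 2 * ((F.C.valuation - F.B.valuation + 1) / 2) := by
    by_cases h : F.C ∣ F.A * F.x s ^ 2
    · exact (h3 s h).le
    · exact (h2 s h).le
  have hC := F.valuation_C_le hΔ
  -- For `p = 2` there are at most `ξ + 8` labels, within `8 (ξ + 1)`. For odd `p ∣ D_Q`, `A B`
  -- takes at least one of the `ξ` factors `p`, which offsets the rounding up and leaves `ξ + 1`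
  -- labels.
  split_ifs at hC ⊢ with h
  · omega
  · have hpD : p ∣ minorGcd Q := ((Fact.out : p.Prime).dvd_mul.1 hp).resolve_left fun h' =>
      h ((Nat.prime_dvd_prime_iff_eq Fact.out Nat.prime_two).1 h')
    have hAB0 := left_ne_zero_of_mul (F.ne_zero hΔ)
    have hAB := F.dvd_A_mul_B hpD
    rw [← pow_one (p : ℤ_[p]), padic_valuation_dvd hAB0, padic_val_mul hAB0] at hAB
    have := F.valuation_add hΔ h
    omega

end TernaryForm

/-! ### Primes with `p ∤ 2 D_Q`, where the form has corank one. -/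

namespace TernaryForm

open MvPolynomial Matrix

namespace PadicFrame

variable {Q : MvPolynomial (Fin 3) ℤ} {p : ℕ} [Fact p.Prime] (F : PadicFrame Q p)

lemma isUnit_A_mul_B (hΔ : discr Q ≠ 0) (hp : ¬ p ∣ 2 * minorGcd Q) : IsUnit (F.A * F.B) := by
  have hp2 : p ≠ 2 := fun h => hp (h ▸ dvd_mul_right _ _)
  refine isUnit_of_dvd_unit (F.A_mul_B_dvd hΔ) (IsUnit.mul ?_ ?_)
  · have : (64 : ℤ_[p]) = 2 ^ 6 := by norm_num
    rw [this]; exact padic_isUnit_two_pow hp2 6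
  · rw [PadicInt.isUnit_iff, PadicInt.norm_natCast_eq_one_iff]
    exact ((Fact.out : p.Prime).coprime_iff_not_dvd).2 fun h => hp (h.mul_left _)

lemma valuation_eq_zero_of_isUnit {a : ℤ_[p]} (h : IsUnit a) : a.valuation = 0 := by
  by_contra h0
  have h1 := (padic_valuation_dvd (p := p) (n := 1) h.ne_zero).2 (by omega)
  rw [pow_one] at h1
  exact PadicInt.p_nonunit (isUnit_of_dvd_unit h1 h)

/-- If the exponent of `p` is odd, a primitive zero cannot be too close to the singular point. -/
lemma not_dvd_of_odd (hQ : Q.IsHomogeneous 2) (hΔ : discr Q ≠ 0)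
    (hp : ¬ p ∣ 2 * minorGcd Q) (hodd : Odd F.C.valuation) (s : PrimitiveZero Q) :
    ¬ F.C ∣ F.A * F.x s ^ 2 := by
  intro h
  have hp2 : p ≠ 2 := fun h => hp (h ▸ dvd_mul_right _ _)
  have hAB := F.isUnit_A_mul_B hΔ hp
  have hA : IsUnit F.A := isUnit_of_mul_isUnit_left hAB
  have hB : IsUnit F.B := isUnit_of_mul_isUnit_right hAB
  have hC0 : F.C ≠ 0 := right_ne_zero_of_mul (F.ne_zero hΔ)
  have hz := F.zero_eq hQ s
  obtain ⟨k, hk⟩ := hodd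
  have hCp := PadicInt.unitCoeff_spec hC0
  rw [hk] at hCp
  -- A square divisible by `p ^ (2k + 1)` has root divisible by `p ^ (k + 1)`. So `x` and `y` gain a
  -- factor, the equation then forces `p ∣ z`, and primitivity fails.
  have key : ∀ t : ℤ_[p], F.C ∣ t ^ 2 → (p : ℤ_[p]) ^ (k + 1) ∣ t := fun t ht => by
    by_cases ht0 : t = 0
    · rw [ht0]; exact dvd_zero _
    · rw [padic_dvd_iff_valuation_le hC0 (pow_ne_zero _ ht0), PadicInt.valuation_pow, hk] at ht
      rw [padic_valuation_dvd ht0]; omega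
  have hx : (p : ℤ_[p]) ^ (k + 1) ∣ F.x s := key _ (hA.dvd_mul_left.1 h)
  have hy : (p : ℤ_[p]) ^ (k + 1) ∣ F.y s := key _ (hB.dvd_mul_left.1 (by
    have e : F.B * F.y s ^ 2 = -(F.A * F.x s ^ 2) - F.C * F.z s ^ 2 := by linear_combination hz
    rw [e]; exact dvd_sub (dvd_neg.2 h) (dvd_mul_right _ _)))
  have hpz : (p : ℤ_[p]) ∣ F.z s := by
    have h1 : (p : ℤ_[p]) ^ (2 * k + 1) * p ∣ (p : ℤ_[p]) ^ (2 * k + 1) * F.z s ^ 2 := by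
      have e : F.C * F.z s ^ 2 = -(F.A * F.x s ^ 2) - F.B * F.y s ^ 2 := by linear_combination hz
      have h2 : (p : ℤ_[p]) ^ (2 * k + 1) * p ∣ F.C * F.z s ^ 2 := by
        have e2 : (p : ℤ_[p]) ^ (2 * k + 1) * p = (p ^ (k + 1)) ^ 2 := by ring
        rw [e, e2]
        exact dvd_sub (dvd_neg.2 ((pow_dvd_pow_of_dvd hx 2).mul_left _))
          ((pow_dvd_pow_of_dvd hy 2).mul_left _)
      rw [hCp, mul_assoc] at h2
      exact Units.dvd_mul_left.1 h2
    exact PadicInt.prime_p.dvd_of_dvd_pow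
      ((mul_dvd_mul_iff_left (pow_ne_zero _ PadicInt.prime_p.ne_zero)).1 h1)
  have hall : ∀ i, (p : ℤ) ∣ s.1 i := fun i => by
    have h8 := cramer_det3 F.u F.v F.w fun i => (s.1 i : ℤ_[p])
    rw [F.det_eq] at h8
    have h8 := congrFun h8 i
    simp only [Pi.add_apply, Pi.smul_apply, smul_eq_mul] at h8
    have hd : (p : ℤ_[p]) ∣ 8 * (s.1 i : ℤ_[p]) := by
      rw [h8]
      have hpk : (p : ℤ_[p]) ∣ p ^ (k + 1) := dvd_pow_self _ (by omega)
      exact dvd_add (dvd_add ((hpk.trans hx).mul_right _) ((hpk.trans hy).mul_right _))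
        (hpz.mul_right _)
    have e8 : (8 : ℤ_[p]) = 2 ^ 3 := by norm_num
    rw [e8, (padic_isUnit_two_pow hp2 3).dvd_mul_left] at hd
    have := (PadicInt.pow_p_dvd_int_iff (p := p) 1 (s.1 i)).1 (by rwa [pow_one])
    rwa [pow_one] at this
  have h1 : (p : ℤ) ∣ Finset.univ.gcd s.1 := Finset.dvd_gcd fun i _ => hall i
  rw [s.2.1] at h1
  exact (Fact.out : p.Prime).one_lt.ne' (by
    have := Int.natAbs_dvd_natAbs.2 h1
    simpa using this)

lemma toZMod_eq_zero_of_dvd {a : ℤ_[p]} (h : (p : ℤ_[p]) ∣ a) : PadicInt.toZMod a = 0 := by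
  obtain ⟨c, rfl⟩ := h
  rw [map_mul, map_natCast, ZMod.natCast_self, zero_mul]

/-- Modulo `p` the frame is still a basis, since 8 is invertible, and diagonalises the form as `(A,
B, 0)` with `A` and `B` non-zero. -/
lemma zerosMod_eq (hQ : Q.IsHomogeneous 2) (hΔ : discr Q ≠ 0) (hp : ¬ p ∣ 2 * minorGcd Q)
    (hpΔ : (p : ℤ) ∣ discr Q) :
    (zerosMod Q p : ℤ) = p * (p - 1) * (1 + quadraticChar (ZMod p)
      (-(PadicInt.toZMod F.A * PadicInt.toZMod F.B))) + p - 1 := by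
  have hp2 : p ≠ 2 := fun h => hp (h ▸ dvd_mul_right _ _)
  have hAB := F.isUnit_A_mul_B hΔ hp
  have hmat : (assocMatrix Q).map (Int.castRingHom (ZMod p))
      = (padicMatrix Q p).map (PadicInt.toZMod (p := p)) := by
    ext i j
    simp
  have hpC : (p : ℤ_[p]) ∣ F.C := by
    have h1 : (p : ℤ_[p]) ∣ F.A * F.B * F.C := by
      rw [F.mul_eq]
      have := (PadicInt.pow_p_dvd_int_iff (p := p) 1 (discr Q)).2 (by rwa [pow_one])
      rw [pow_one] at this
      exact this.mul_left _
    rwa [hAB.dvd_mul_left] at h1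
  have hb := bil_map (PadicInt.toZMod (p := p)) (padicMatrix Q p)
  refine TernaryForm.zerosMod_eq hQ hp2 (u := fun i => PadicInt.toZMod (F.u i))
    (v := fun i => PadicInt.toZMod (F.v i)) (w := fun i => PadicInt.toZMod (F.w i))
    ?_ ?_ ?_ ?_ ?_ ?_ ?_ ?_
  · rw [det3_map, F.det_eq]
    have e8 : (8 : ℤ_[p]) = 2 ^ 3 := by norm_num
    rw [e8]
    exact ((padic_isUnit_two_pow hp2 3).map PadicInt.toZMod).ne_zero
  · rw [hmat, hb, F.uv, map_zero]
  · rw [hmat, hb, F.uw, map_zero]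
  · rw [hmat, hb, F.vw, map_zero]
  · rw [hmat, hb]; exact toZMod_eq_zero_of_dvd hpC
  · rw [hmat, hb]; rfl
  · rw [hmat, hb]; rfl
  · exact ((isUnit_of_mul_isUnit_left hAB).map PadicInt.toZMod).ne_zero

/-- A zero with small invariant forces the form to split modulo `p`. -/
lemma quadraticChar_eq_one (hQ : Q.IsHomogeneous 2) (hΔ : discr Q ≠ 0)
    (hp : ¬ p ∣ 2 * minorGcd Q) {s : PrimitiveZero Q} (hs : ¬ F.C ∣ F.A * F.x s ^ 2) :
    quadraticChar (ZMod p) (-(PadicInt.toZMod F.A * PadicInt.toZMod F.B)) = 1 := by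
  have h0 := F.ne_zero hΔ
  have hAB := F.isUnit_A_mul_B hΔ hp
  have hA : IsUnit F.A := isUnit_of_mul_isUnit_left hAB
  have hB : IsUnit F.B := isUnit_of_mul_isUnit_right hAB
  obtain ⟨hx, hy, -, h1, h2⟩ := valuation_of_not_dvd (Y := PrimitiveZero Q)
    (x := fun s => F.x s) (y := fun s => F.y s) (z := fun s => F.z s) hA.ne_zero hB.ne_zero
    (right_ne_zero_of_mul h0) (F.zero_eq hQ) hs
  rw [valuation_eq_zero_of_isUnit hA, valuation_eq_zero_of_isUnit hB] at h1
  rw [valuation_eq_zero_of_isUnit hB] at h2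
  have hz := F.zero_eq hQ s
  set n := (F.x s).valuation with hn
  have hyn : (F.y s).valuation = n := by omega
  have ex := PadicInt.unitCoeff_spec hx
  have ey := PadicInt.unitCoeff_spec hy
  have eC := PadicInt.unitCoeff_spec (right_ne_zero_of_mul h0)
  rw [← hn] at ex
  rw [hyn] at ey
  obtain ⟨m, hm⟩ : ∃ m, F.C.valuation = 2 * n + (m + 1) := ⟨F.C.valuation - 2 * n - 1, by omega⟩
  rw [hm] at eC
  set a : ℤ_[p] := (PadicInt.unitCoeff hx : ℤ_[p]) with ha
  set b : ℤ_[p] := (PadicInt.unitCoeff hy : ℤ_[p]) with hb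
  set c : ℤ_[p] := (PadicInt.unitCoeff (right_ne_zero_of_mul h0) : ℤ_[p])
  -- Dividing the equation by `p ^ (2n)` leaves unit coordinates and a multiple of `p`; reducing
  -- exhibits `-AB` as a square.
  have hab : F.A * a ^ 2 + F.B * b ^ 2 = p * (-(c * p ^ m * F.z s ^ 2)) := by
    have hpn : ((p : ℤ_[p]) ^ (2 * n)) ≠ 0 := pow_ne_zero _ PadicInt.prime_p.ne_zero
    refine mul_left_cancel₀ hpn ?_
    have e := hz
    rw [ex, ey] at e
    conv at e => lhs; arg 2; rw [eC]
    linear_combination e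
  have h3 := congrArg PadicInt.toZMod hab
  rw [toZMod_eq_zero_of_dvd (dvd_mul_right _ _), map_add, map_mul, map_mul, map_pow, map_pow] at h3
  have hb0 : PadicInt.toZMod b ≠ 0 := ((PadicInt.unitCoeff hy).isUnit.map PadicInt.toZMod).ne_zero
  have ha0 : PadicInt.toZMod a ≠ 0 := ((PadicInt.unitCoeff hx).isUnit.map PadicInt.toZMod).ne_zero
  have hA0 : PadicInt.toZMod F.A ≠ 0 := (hA.map PadicInt.toZMod).ne_zero
  have e : -(PadicInt.toZMod F.A * PadicInt.toZMod F.B)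
      = (PadicInt.toZMod F.A * PadicInt.toZMod a / PadicInt.toZMod b) ^ 2 := by
    field_simp
    linear_combination -h3
  rw [e]
  exact quadraticChar_sq_one' (div_ne_zero (mul_ne_zero hA0 ha0) hb0)

end PadicFrame

/-- Local classes at a prime where the form has corank one. -/
lemma exists_classes_of_not_dvd {Q : MvPolynomial (Fin 3) ℤ} (hQ : Q.IsHomogeneous 2)
    (hΔ : discr Q ≠ 0) {p : ℕ} [Fact p.Prime] (hp : ¬ p ∣ 2 * minorGcd Q)
    (hpΔ : (p : ℤ) ∣ discr Q) :
    ∃ ε : ℤ, (ε = 1 ∨ ε = -1) ∧ (zerosMod Q p : ℤ) = p * (p - 1) * (1 + ε) + p - 1 ∧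
      ∃ c : PrimitiveZero Q → ℕ, (∀ s t, c s = c t →
          (p : ℤ) ^ (discr Q).natAbs.factorization p ∣
            2 ^ 14 * minorGcd Q * bil (assocMatrix Q) s t) ∧
        ∀ s, (c s : ℤ) < ∑ k ∈ Finset.range ((discr Q).natAbs.factorization p + 1), ε ^ k := by
  have hp2 : p ≠ 2 := fun h => hp (h ▸ dvd_mul_right _ _)
  obtain ⟨F⟩ := padicFrame_nonempty Q p
  have hAB := F.isUnit_A_mul_B hΔ hp
  have hA : IsUnit F.A := isUnit_of_mul_isUnit_left hAB
  have hB : IsUnit F.B := isUnit_of_mul_isUnit_right hAB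
  have hv := F.valuation_add hΔ hp2
  rw [PadicFrame.valuation_eq_zero_of_isUnit hA, PadicFrame.valuation_eq_zero_of_isUnit hB, zero_add, zero_add] at hv
  obtain ⟨c, h1, h2, h3⟩ := F.exists_classes hQ hΔ
  rw [PadicFrame.valuation_eq_zero_of_isUnit hB] at h2 h3
  rw [← hv] at h1 ⊢
  have hne : -(PadicInt.toZMod F.A * PadicInt.toZMod F.B) ≠ 0 :=
    neg_ne_zero.2 (mul_ne_zero (hA.map PadicInt.toZMod).ne_zero (hB.map PadicInt.toZMod).ne_zero)
  refine ⟨_, quadraticChar_dichotomy hne, F.zerosMod_eq hQ hΔ hp hpΔ, ?_⟩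
  rcases quadraticChar_dichotomy hne with hε | hε
  · refine ⟨c, h1, fun s => ?_⟩
    rw [hε]
    simp only [one_pow, Finset.sum_const, Finset.card_range, mul_one, nsmul_eq_mul]
    -- For odd `ξ` there are `ξ + 1` sign labels and the singular class is empty; for even `ξ` there
    -- are `ξ` sign labels and one singular class.
    have h4 : c s < F.C.valuation + 1 := by
      by_cases hs : F.C ∣ F.A * F.x s ^ 2
      · have h5 : ¬ Odd F.C.valuation := fun ho => F.not_dvd_of_odd hQ hΔ hp ho s hs
        rw [Nat.not_odd_iff_even] at h5
        obtain ⟨m, hm⟩ := h5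
        have := h3 s hs
        omega
      · have := h2 s hs
        omega
    exact_mod_cast h4
  · have hall : ∀ s : PrimitiveZero Q, F.C ∣ F.A * F.x s ^ 2 := fun s => by
      by_contra hs
      have := F.quadraticChar_eq_one hQ hΔ hp hs
      rw [hε] at this
      norm_num at this
    -- All zeros lie in the singular class, so one label suffices. The alternating sum is 1 for even
    -- `ξ`; for odd `ξ` it is 0, but then there is no primitive zero at all.
    refine ⟨fun _ => 0, fun s t _ => h1 s t (by rw [h3 s (hall s), h3 t (hall t)]), fun s => ?_⟩
    have h5 : ¬ Odd F.C.valuation := fun ho => F.not_dvd_of_odd hQ hΔ hp ho s (hall s)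
    rw [Nat.not_odd_iff_even] at h5
    rw [hε, neg_one_geom_sum, if_neg (by rw [Nat.not_even_iff_odd]; exact h5.add_one)]
    norm_num

end TernaryForm

/-! ### Existence of the character. -/

namespace TernaryForm

open MvPolynomial Matrix

lemma exists_legendreSym_eq {p : ℕ} [Fact p.Prime] (hp : p ≠ 2) {ε : ℤ} (hε : ε = 1 ∨ ε = -1) :
    ∃ a : ℕ, legendreSym p a = ε := by
  rcases hε with rfl | rfl
  · exact ⟨1, by simp⟩
  · obtain ⟨a, ha⟩ := quadraticChar_exists_neg_one (F := ZMod p) (by rwa [ZMod.ringChar_zmod_n])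
    exact ⟨a.val, by simpa [legendreSym] using ha⟩

/-- A quadratic character with prescribed signs at finitely many odd primes. -/
lemma exists_quadratic_character (P : Finset ℕ) (hP : ∀ p ∈ P, p.Prime ∧ p ≠ 2) (ε : ℕ → ℤ)
    (hε : ∀ p ∈ P, ε p = 1 ∨ ε p = -1) :
    ∃ (q : ℕ) (_ : NeZero q) (χ : DirichletCharacter ℤ q), MulChar.IsQuadratic χ ∧
      ∀ p ∈ P, χ (p : ZMod q) = ε p := by
  classical
  have hex : ∀ p : ℕ, ∃ a : ℕ, p ∈ P → ∀ [Fact p.Prime], legendreSym p a = ε p := fun p => by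
    by_cases hp : p ∈ P
    · have : Fact p.Prime := ⟨(hP p hp).1⟩
      obtain ⟨a, ha⟩ := exists_legendreSym_eq (hP p hp).2 (hε p hp)
      exact ⟨a, fun _ _ => ha⟩
    · exact ⟨0, fun h => absurd h hp⟩
  choose a ha using hex
  set S := insert 2 P with hS
  set s : ℕ → ℕ := fun p => if p = 2 then 4 else p with hs
  have hSprime : ∀ p ∈ S, p.Prime := fun p hp => by
    rcases Finset.mem_insert.1 hp with rfl | h
    · exact Nat.prime_two
    · exact (hP p h).1
  have hs0 : ∀ p ∈ S, s p ≠ 0 := fun p hp => by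
    have := (hSprime p hp).ne_zero
    simp only [hs]; split_ifs <;> omega
  have hspow : ∀ p, s p ∣ p ^ 2 := fun p => by
    simp only [hs]; split_ifs with h
    · rw [h]; norm_num
    · exact dvd_pow_self _ two_ne_zero
  have hcop : Set.Pairwise (S : Set ℕ) (Function.onFun Nat.Coprime s) := fun p hp q hq hpq =>
    Nat.Coprime.of_dvd (hspow p) (hspow q)
      (((Nat.coprime_primes (hSprime p hp) (hSprime q hq)).2 hpq).pow 2 2)
  -- A residue `k` that is 1 modulo 4 and has the prescribed Legendre symbol at every `p ∈ P`. For a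
  -- prime `q ≡ k`, given by Dirichlet's theorem, reciprocity has no sign and the quadratic
  -- character modulo `q` takes the value `ε p` at `p`.
  obtain ⟨k, hk⟩ := Nat.chineseRemainderOfFinset (fun p => if p = 2 then 1 else a p) s S hs0 hcop
  have hk2 : k % 4 = 1 := by
    have := hk 2 (Finset.mem_insert_self _ _)
    simpa [hs, Nat.ModEq] using this
  have hkp : ∀ p ∈ P, k ≡ a p [MOD p] := fun p hp => by
    have := hk p (Finset.mem_insert_of_mem hp)
    simpa [hs, (hP p hp).2] using this
  have hleg : ∀ p ∈ P, ∀ [Fact p.Prime] (n : ℕ), n ≡ k [MOD p] → legendreSym p n = ε p :=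
    fun p hp _ n hn => by
      rw [← ha p hp, legendreSym, legendreSym]
      congr 1
      push_cast
      exact (ZMod.natCast_eq_natCast_iff _ _ _).2 (hn.trans (hkp p hp))
  set m := 4 * ∏ p ∈ P, p with hm
  have hm0 : m ≠ 0 := mul_ne_zero (by norm_num)
    (Finset.prod_ne_zero_iff.2 fun p hp => (hP p hp).1.ne_zero)
  have : NeZero m := ⟨hm0⟩
  have hunit : IsUnit (k : ZMod m) := by
    rw [ZMod.isUnit_iff_coprime, hm]
    refine Nat.Coprime.mul_right ?_ (Nat.Coprime.prod_right fun p hp => ?_)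
    · have : Nat.Coprime k (2 ^ 2) := Nat.Coprime.pow_right 2 (by
        rw [Nat.coprime_two_right, Nat.odd_iff]; omega)
      simpa using this
    · have : Fact p.Prime := ⟨(hP p hp).1⟩
      refine Nat.Coprime.symm (((hP p hp).1.coprime_iff_not_dvd).2 fun h => ?_)
      have h1 := hleg p hp k rfl
      have h2 : legendreSym p k = 0 := by
        rw [legendreSym.eq_zero_iff]
        simpa using (ZMod.natCast_eq_zero_iff _ _).2 h
      rcases hε p hp with h3 | h3 <;> omega
  obtain ⟨q, -, hq, hqk⟩ := Nat.forall_exists_prime_gt_and_eq_mod hunit 0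
  have hqk : q ≡ k [MOD m] := (ZMod.natCast_eq_natCast_iff _ _ _).1 hqk
  have hq4 : q % 4 = 1 := by
    have : q ≡ k [MOD 4] := hqk.of_dvd (dvd_mul_right _ _)
    rw [← hk2]; exact this
  have : Fact q.Prime := ⟨hq⟩
  refine ⟨q, inferInstance, quadraticChar (ZMod q), quadraticChar_isQuadratic _, fun p hp => ?_⟩
  have : Fact p.Prime := ⟨(hP p hp).1⟩
  have h1 := hleg p hp q (hqk.of_dvd ((Finset.dvd_prod_of_mem _ hp).mul_left _))
  rw [← h1, legendreSym.quadratic_reciprocity_one_mod_four hq4 (hP p hp).2]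
  simp [legendreSym]

lemma exists_assocCharacter {Q : MvPolynomial (Fin 3) ℤ} (hQ : Q.IsHomogeneous 2)
    (hΔ : discr Q ≠ 0) :
    ∃ (N : ℕ) (_ : NeZero N) (χ : DirichletCharacter ℤ N), IsAssocCharacter Q χ := by
  classical
  have hex : ∀ p : ℕ, ∃ ε : ℤ, p.Prime → (p : ℤ) ∣ discr Q → ¬ p ∣ 2 * minorGcd Q →
      (ε = 1 ∨ ε = -1) ∧ (zerosMod Q p : ℤ) = p * (p - 1) * (1 + ε) + p - 1 := fun p => by
    by_cases h : p.Prime ∧ (p : ℤ) ∣ discr Q ∧ ¬ p ∣ 2 * minorGcd Q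
    · have : Fact p.Prime := ⟨h.1⟩
      obtain ⟨ε, h1, h2, -⟩ := exists_classes_of_not_dvd hQ hΔ h.2.2 h.2.1
      exact ⟨ε, fun _ _ _ => ⟨h1, h2⟩⟩
    · exact ⟨0, fun h1 h2 h3 => absurd ⟨h1, h2, h3⟩ h⟩
  choose ε hε using hex
  have hmem : ∀ p ∈ (discr Q).natAbs.primeFactors.filter fun p => ¬ p ∣ 2 * minorGcd Q,
      p.Prime ∧ (p : ℤ) ∣ discr Q ∧ ¬ p ∣ 2 * minorGcd Q := fun p hp => by
    obtain ⟨h1, h2⟩ := Finset.mem_filter.1 hp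
    exact ⟨Nat.prime_of_mem_primeFactors h1,
      Int.natCast_dvd.2 (Nat.dvd_of_mem_primeFactors h1), h2⟩
  obtain ⟨q, hq, χ, hχ, h⟩ := exists_quadratic_character
    ((discr Q).natAbs.primeFactors.filter fun p => ¬ p ∣ 2 * minorGcd Q)
    (fun p hp => ⟨(hmem p hp).1, fun h => (hmem p hp).2.2 (h ▸ dvd_mul_right _ _)⟩) ε
    (fun p hp => (hε p (hmem p hp).1 (hmem p hp).2.1 (hmem p hp).2.2).1)
  refine ⟨q, hq, χ, hχ, fun p hp hpΔ hpD => ?_⟩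
  rw [h p (Finset.mem_filter.2 ⟨Nat.mem_primeFactors.2
    ⟨hp, Int.natCast_dvd.1 hpΔ, Int.natAbs_ne_zero.2 hΔ⟩, hpD⟩)]
  exact (hε p hp hpΔ hpD).2

/-! ### Gluing the local classes and counting. -/

open Classical in
/-- The factor of `constC` at the prime `p`. -/
noncomputable def localFactor (Q : MvPolynomial (Fin 3) ℤ) {N : ℕ} (χ : DirichletCharacter ℤ N)
    (w : ℝ) (p : ℕ) : ℤ :=
  if p ∣ 2 * minorGcd Q ∨ (p : ℝ) ≤ w then ((discr Q).natAbs.factorization p + 1 : ℕ)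
  else ∑ k ∈ Finset.range ((discr Q).natAbs.factorization p + 1), χ (p : ZMod N) ^ k

lemma constC_eq_prod (Q : MvPolynomial (Fin 3) ℤ) {N : ℕ} (χ : DirichletCharacter ℤ N) (w : ℝ) :
    constC Q χ w = ∏ p ∈ (discr Q).natAbs.primeFactors, localFactor Q χ w p := by
  classical
  rw [← Finset.prod_filter_mul_prod_filter_not _
    (fun p : ℕ => p ∣ 2 * minorGcd Q ∨ (p : ℝ) ≤ w), constC]
  congr 1
  · refine Finset.prod_congr (by congr) fun p hp => ?_
    obtain ⟨h1, h2⟩ := Finset.mem_filter.1 hp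
    rw [localFactor, if_pos h2, Nat.divisors_prime_pow (Nat.prime_of_mem_primeFactors h1)]
    simp
  · refine Finset.prod_congr ?_ fun p hp => ?_
    · ext p; simp [not_or, not_le]
    · rw [localFactor, if_neg (Finset.mem_filter.1 hp).2]

lemma geom_sum_sign_le {ε : ℤ} (hε : ε = 1 ∨ ε = -1) (n : ℕ) :
    0 ≤ ∑ k ∈ Finset.range (n + 1), ε ^ k ∧ ∑ k ∈ Finset.range (n + 1), ε ^ k ≤ n + 1 := by
  rcases hε with rfl | rfl
  · simp; omega
  · rw [neg_one_geom_sum]; split_ifs <;> constructor <;> omega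

lemma exists_local_classes {Q : MvPolynomial (Fin 3) ℤ} (hQ : Q.IsHomogeneous 2)
    (hΔ : discr Q ≠ 0) {N : ℕ} {χ : DirichletCharacter ℤ N} (hχ : IsAssocCharacter Q χ) (w : ℝ)
    {p : ℕ} (hp : p ∈ (discr Q).natAbs.primeFactors) :
    0 ≤ localFactor Q χ w p ∧ ∃ c : PrimitiveZero Q → ℕ, (∀ s t, c s = c t →
        (p : ℤ) ^ (discr Q).natAbs.factorization p ∣
          2 ^ 14 * minorGcd Q * bil (assocMatrix Q) s t) ∧
      ∀ s, (c s : ℤ) < localFactor Q χ w p * if p = 2 then 8 else 1 := by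
  have hprime := Nat.prime_of_mem_primeFactors hp
  have hpΔ : (p : ℤ) ∣ discr Q := Int.natCast_dvd.2 (Nat.dvd_of_mem_primeFactors hp)
  have : Fact p.Prime := ⟨hprime⟩
  by_cases hD : p ∣ 2 * minorGcd Q
  · obtain ⟨c, h1, h2⟩ := exists_classes_of_dvd hQ hΔ hD
    rw [localFactor, if_pos (Or.inl hD)]
    exact ⟨by positivity, c, h1, fun s => by exact_mod_cast h2 s⟩
  · obtain ⟨ε, hε, hz, c, h1, h2⟩ := exists_classes_of_not_dvd hQ hΔ hD hpΔ
    have h3 := hχ.2 p hprime hpΔ hD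
    -- The number of zeros modulo `p` determines the value of the character, so any admissible `χ`
    -- agrees with the local sign.
    have hχε : χ (p : ZMod N) = ε := by
      rw [hz] at h3
      have h4 : ((p : ℤ) * (p - 1)) * (ε - χ (p : ZMod N)) = 0 := by linear_combination h3
      have h5 : (2 : ℤ) ≤ p := by exact_mod_cast hprime.two_le
      have h6 : (p : ℤ) * (p - 1) ≠ 0 := mul_ne_zero (by omega) (by omega)
      have := (mul_eq_zero.1 h4).resolve_left h6
      omega
    have hp2 : p ≠ 2 := fun h => hD (h ▸ dvd_mul_right _ _)
    obtain ⟨g1, g2⟩ := geom_sum_sign_le hε ((discr Q).natAbs.factorization p)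
    rw [if_neg hp2, mul_one, localFactor, hχε]
    split_ifs with h
    · exact ⟨by positivity, c, h1, fun s => (h2 s).trans_le (by exact_mod_cast g2)⟩
    · exact ⟨g1, c, h1, h2⟩

lemma constC_nonneg {Q : MvPolynomial (Fin 3) ℤ} (hQ : Q.IsHomogeneous 2)
    (hΔ : discr Q ≠ 0) {N : ℕ} {χ : DirichletCharacter ℤ N} (hχ : IsAssocCharacter Q χ) (w : ℝ) :
    0 ≤ constC Q χ w := by
  rw [constC_eq_prod]
  exact Finset.prod_nonneg fun p hp => (exists_local_classes hQ hΔ hχ w hp).1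

/-- The primitive zeros fall into at most `8 C(Q, w)` classes on which the bilinear form is
divisible by `Δ`, up to the factor `2 ^ 14 D`. -/
lemma exists_global_classes {Q : MvPolynomial (Fin 3) ℤ} (hQ : Q.IsHomogeneous 2)
    (hΔ : discr Q ≠ 0) {N : ℕ} {χ : DirichletCharacter ℤ N} (hχ : IsAssocCharacter Q χ) (w : ℝ) :
    ∃ (κ : Type) (_ : DecidableEq κ) (f : (Fin 3 → ℤ) → κ) (K : Finset κ),
      (K.card : ℤ) ≤ 8 * constC Q χ w ∧
      (∀ y, Finset.univ.gcd y = 1 → eval y Q = 0 → f y ∈ K) ∧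
      ∀ s t, (Finset.univ.gcd s = 1 ∧ eval s Q = 0) → (Finset.univ.gcd t = 1 ∧ eval t Q = 0) →
        f s = f t → discr Q ∣ 2 ^ 14 * minorGcd Q * bil (assocMatrix Q) s t := by
  classical
  set P := (discr Q).natAbs.primeFactors with hP
  have hloc := fun p : P => exists_local_classes hQ hΔ hχ w p.2
  choose h0 c hc hlt using hloc
  set n : P → ℕ := fun p => (localFactor Q χ w p * if (p : ℕ) = 2 then 8 else 1).toNat with hn
  have hn0 : ∀ p : P, 0 ≤ localFactor Q χ w p * if (p : ℕ) = 2 then 8 else 1 := fun p =>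
    mul_nonneg (h0 p) (by split_ifs <;> norm_num)
  refine ⟨P → ℕ, inferInstance, fun y p => if h : Finset.univ.gcd y = 1 ∧ eval y Q = 0
    then c p ⟨y, h⟩ else 0, Fintype.piFinset fun p => Finset.range (n p), ?_, ?_, ?_⟩
  · rw [Fintype.card_piFinset]
    push_cast
    simp only [Finset.card_range]
    have e : ∀ p : P, (n p : ℤ) = localFactor Q χ w p * if (p : ℕ) = 2 then 8 else 1 := fun p =>
      Int.toNat_of_nonneg (hn0 p)
    simp only [e]
    -- Only the prime 2, if it divides `Δ`, contributes an extra factor, and that factor is 8.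
    rw [Finset.prod_coe_sort P (fun p => localFactor Q χ w p * if p = 2 then 8 else 1),
      Finset.prod_mul_distrib, ← constC_eq_prod, Finset.prod_ite_eq', mul_comm]
    refine mul_le_mul_of_nonneg_right ?_ (constC_nonneg hQ hΔ hχ w)
    split_ifs <;> norm_num
  · intro y h1 h2
    rw [Fintype.mem_piFinset]
    intro p
    simp only [h1, h2, and_self, dif_pos, Finset.mem_range]
    have := hlt p ⟨y, h1, h2⟩
    have := Int.toNat_of_nonneg (hn0 p)
    simp only [hn]
    omega
  · intro s t hs ht hst
    rw [← Int.natAbs_dvd_natAbs, Nat.dvd_iff_prime_pow_dvd_dvd]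
    intro p k hp hpk
    rcases Nat.eq_zero_or_pos k with rfl | hk
    · simp
    have hmem : p ∈ P := Nat.mem_primeFactors.2
      ⟨hp, (dvd_pow_self p hk.ne').trans hpk, Int.natAbs_ne_zero.2 hΔ⟩
    have h1 := congrFun hst ⟨p, hmem⟩
    simp only [dif_pos hs, dif_pos ht] at h1
    have h2 := hc ⟨p, hmem⟩ _ _ h1
    have h3 := (hp.pow_dvd_iff_le_factorization (Int.natAbs_ne_zero.2 hΔ)).1 hpk
    rw [← Int.natCast_dvd]
    push_cast
    exact (pow_dvd_pow _ h3).trans h2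

/-- Three independent zeros in one class span a large parallelepiped. -/
lemma discr_sq_le {Q : MvPolynomial (Fin 3) ℤ} (hQ : Q.IsHomogeneous 2) (hΔ : discr Q ≠ 0)
    {s t u : Fin 3 → ℤ} (hs : eval s Q = 0) (ht : eval t Q = 0) (hu : eval u Q = 0)
    (hst : discr Q ∣ 2 ^ 14 * minorGcd Q * bil (assocMatrix Q) s t)
    (htu : discr Q ∣ 2 ^ 14 * minorGcd Q * bil (assocMatrix Q) t u)
    (hsu : discr Q ∣ 2 ^ 14 * minorGcd Q * bil (assocMatrix Q) s u) (hd : det3 s t u ≠ 0) :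
    discr Q ^ 2 ≤ 2 ^ 42 * (minorGcd Q : ℤ) ^ 3 * det3 s t u ^ 2 := by
  have hg := gram_det (assocMatrix_isSymm Q) s t u
  rw [bil_eq_zero_of_eval hQ hs, bil_eq_zero_of_eval hQ ht, bil_eq_zero_of_eval hQ hu] at hg
  set a := bil (assocMatrix Q) s t
  set b := bil (assocMatrix Q) t u
  set c := bil (assocMatrix Q) s u
  set D : ℤ := (minorGcd Q : ℤ) with hD
  have hD0 : 0 < D := by
    have := minorGcd_ne_zero hΔ
    omega
  have hg : det3 s t u ^ 2 * discr Q = 2 * (a * b * c) := by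
    rw [discr]; linear_combination hg
  -- Independence makes all three products `b(·,·)` non-zero, so that divisibility bounds each from
  -- below in absolute value.
  have hne : a * b * c ≠ 0 := fun h => by
    rw [h, mul_zero] at hg
    exact mul_ne_zero (pow_ne_zero 2 hd) hΔ hg
  have key : ∀ x : ℤ, x ≠ 0 → discr Q ∣ 2 ^ 14 * D * x → |discr Q| ≤ 2 ^ 14 * D * |x| :=
    fun x hx h => by
      have h1 := Int.le_of_dvd (abs_pos.2 (mul_ne_zero (by positivity) hx))
        ((abs_dvd_abs _ _).2 h)
      rwa [abs_mul, abs_of_pos (by positivity : (0 : ℤ) < 2 ^ 14 * D)] at h1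
  have ha := key a (left_ne_zero_of_mul (left_ne_zero_of_mul hne)) hst
  have hb := key b (right_ne_zero_of_mul (left_ne_zero_of_mul hne)) htu
  have hc := key c (right_ne_zero_of_mul hne) hsu
  have h1 : |discr Q| * |discr Q| * |discr Q|
      ≤ (2 ^ 14 * D * |a|) * (2 ^ 14 * D * |b|) * (2 ^ 14 * D * |c|) := by gcongr
  have h2 : 2 * (|a| * |b| * |c|) = det3 s t u ^ 2 * |discr Q| := by
    have := congrArg abs hg
    rw [abs_mul, abs_mul, abs_mul, abs_mul, abs_pow, sq_abs] at this
    rw [this]; norm_num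
  have hΔ0 : 0 < |discr Q| := abs_pos.2 hΔ
  have h3 : |discr Q| * (2 * discr Q ^ 2) ≤ |discr Q| * (2 ^ 42 * D ^ 3 * det3 s t u ^ 2) := by
    rw [← sq_abs (discr Q)]
    linear_combination 2 * h1 + 2 ^ 42 * D ^ 3 * h2
  have h4 := le_of_mul_le_mul_left h3 hΔ0
  nlinarith [sq_nonneg (discr Q)]

lemma primitiveZeros_finite (Q : MvPolynomial (Fin 3) ℤ) (B : Fin 3 → ℝ) :
    (primitiveZeros Q B).Finite := by
  refine (Set.finite_Icc (fun i => -⌊B i⌋) fun i => ⌊B i⌋).subset fun y hy => ?_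
  have h : ∀ i, |y i| ≤ ⌊B i⌋ := fun i => by
    rw [Int.le_floor]; exact_mod_cast hy.2.2 i
  exact ⟨fun i => (abs_le.1 (h i)).1, fun i => (abs_le.1 (h i)).2⟩

/-- Within one class, `discr_sq_le` and the choice of `r` give the determinant hypothesis of
`card_conic_le`. Isotropy supplies the real point from which the conic is parametrised. -/
lemma ncard_primitiveZeros_le {Q : MvPolynomial (Fin 3) ℤ} (hQ : Q.IsHomogeneous 2)
    (hΔ : discr Q ≠ 0) (hiso : IsIsotropic Q) {N : ℕ} {χ : DirichletCharacter ℤ N}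
    (hχ : IsAssocCharacter Q χ) (w : ℝ) {B : Fin 3 → ℝ} (hB : ∀ i, 0 < B i) {r : ℝ} (hr : 0 < r)
    (hrB : (r ^ 3 * (B 0 * B 1 * B 2)) ^ 2 * (2 ^ 42 * (minorGcd Q : ℝ) ^ 3)
      ≤ (discr Q : ℝ) ^ 2) :
    ((primitiveZeros Q B).ncard : ℝ) * r ≤ 8 * (constC Q χ w : ℝ) * (416 * r + 624) := by
  classical
  obtain ⟨κ, _, f, K, hK, hf, hcls⟩ := exists_global_classes hQ hΔ hχ w
  have hfin := primitiveZeros_finite Q B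
  rw [Set.ncard_eq_toFinset_card _ hfin]
  set X := hfin.toFinset with hX
  have hmem : ∀ y ∈ X, Finset.univ.gcd y = 1 ∧ eval y Q = 0 ∧ ∀ i, |(y i : ℝ)| ≤ B i :=
    fun y hy => by rwa [hX, Set.Finite.mem_toFinset] at hy
  obtain ⟨e, he, hQe⟩ := hiso
  set MR := (assocMatrix Q).map (Int.castRingHom ℝ) with hMR
  have hsymm : MR.IsSymm := (assocMatrix_isSymm Q).map _
  have hdet : MR.det ≠ 0 := by
    have : MR.det = (discr Q : ℝ) := by
      rw [discr, ← eq_intCast (Int.castRingHom ℝ), RingHom.map_det]; rfl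
    rw [this]; exact_mod_cast hΔ
  have hee : bil MR (fun i => (e i : ℝ)) (fun i => (e i : ℝ)) = 0 := by
    have h1 := two_mul_aeval hQ e
    rw [hQe, mul_zero] at h1
    have h2 := bil_map (Rat.castHom ℝ) ((assocMatrix Q).map (Int.castRingHom ℚ)) e e
    rw [← h1, map_zero] at h2
    rw [← h2]
    congr 1
  have he0 : (fun i => (e i : ℝ)) ≠ 0 := fun h => he (by
    ext i
    have := congrFun h i
    simpa using this)
  have hmain := card_mul_le_of_fibers (T := X) (K := K) (f := f) (r := r)
    (B := 416 * r + 624) (fun y hy => hf y (hmem y hy).1 (hmem y hy).2.1) fun k _ => by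
      have hm : ∀ y ∈ X.filter fun y => f y = k, y ∈ X ∧ f y = k := fun y hy =>
        Finset.mem_filter.1 hy
      refine card_conic_le hsymm hdet he0 hee hB hr (fun y hy => (hmem y (hm y hy).1).1)
        (fun y hy => ?_) (fun y hy => (hmem y (hm y hy).1).2.2) ?_
      · have h1 := bil_map (Int.castRingHom ℝ) (assocMatrix Q) y y
        rw [bil_eq_zero_of_eval hQ (hmem y (hm y hy).1).2.1, map_zero] at h1
        exact h1
      · intro s hs t ht u hu hd
        obtain ⟨hsX, hsk⟩ := hm s hs
        obtain ⟨htX, htk⟩ := hm t ht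
        obtain ⟨huX, huk⟩ := hm u hu
        have hs' := hmem s hsX
        have ht' := hmem t htX
        have hu' := hmem u huX
        have h1 := discr_sq_le hQ hΔ hs'.2.1 ht'.2.1 hu'.2.1
          (hcls s t ⟨hs'.1, hs'.2.1⟩ ⟨ht'.1, ht'.2.1⟩ (hsk.trans htk.symm))
          (hcls t u ⟨ht'.1, ht'.2.1⟩ ⟨hu'.1, hu'.2.1⟩ (htk.trans huk.symm))
          (hcls s u ⟨hs'.1, hs'.2.1⟩ ⟨hu'.1, hu'.2.1⟩ (hsk.trans huk.symm)) hd
        have h2 : (discr Q : ℝ) ^ 2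
            ≤ 2 ^ 42 * (minorGcd Q : ℝ) ^ 3 * ((det3 s t u : ℤ) : ℝ) ^ 2 := by exact_mod_cast h1
        have hD0 : 0 < (minorGcd Q : ℝ) := by
          exact_mod_cast Nat.pos_of_ne_zero (minorGcd_ne_zero hΔ)
        have h3 : (r ^ 3 * (B 0 * B 1 * B 2)) ^ 2 ≤ ((det3 s t u : ℤ) : ℝ) ^ 2 := by
          refine le_of_mul_le_mul_right ?_ (by positivity : 0 < 2 ^ 42 * (minorGcd Q : ℝ) ^ 3)
          linarith
        exact (le_abs_self _).trans (sq_le_sq.1 h3)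
  refine hmain.trans (mul_le_mul_of_nonneg_right ?_ (by positivity))
  exact_mod_cast hK

end TernaryForm

theorem lemma2p4 :
    ∃ c : ℝ, 0 < c ∧
      ∀ Q : MvPolynomial (Fin 3) ℤ, Q.IsHomogeneous 2 → TernaryForm.discr Q ≠ 0 →
        TernaryForm.IsIsotropic Q →
        (∃ (N : ℕ) (_ : NeZero N) (χ : DirichletCharacter ℤ N),
            TernaryForm.IsAssocCharacter Q χ) ∧
        ∀ (N : ℕ) [NeZero N] (χ : DirichletCharacter ℤ N), TernaryForm.IsAssocCharacter Q χ →
          ∀ (w B₁ B₂ B₃ : ℝ), 0 < w → 0 < B₁ → 0 < B₂ → 0 < B₃ →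
            ((TernaryForm.primitiveZeros Q ![B₁, B₂, B₃]).ncard : ℝ) ≤
              c * (TernaryForm.constC Q χ w : ℝ) *
                (1 + (B₁ * B₂ * B₃) ^ (1 / 3 : ℝ) * (TernaryForm.minorGcd Q : ℝ) ^ (1 / 2 : ℝ) /
                  |(TernaryForm.discr Q : ℝ)| ^ (1 / 3 : ℝ)) := by
  -- 8 from the prime 2, 624 from `card_conic_le`, and `2 ^ 7` from the denominator of `r`.
  refine ⟨8 * 624 * 2 ^ 7, by norm_num, fun Q hQ hΔ hiso =>
    ⟨TernaryForm.exists_assocCharacter hQ hΔ, fun N _ χ hχ w B₁ B₂ B₃ _ h1 h2 h3 => ?_⟩⟩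
  have hD : 0 < (TernaryForm.minorGcd Q : ℝ) := by
    exact_mod_cast Nat.pos_of_ne_zero (TernaryForm.minorGcd_ne_zero hΔ)
  have hΔ0 : 0 < |(TernaryForm.discr Q : ℝ)| := abs_pos.2 (by exact_mod_cast hΔ)
  have hV : 0 < B₁ * B₂ * B₃ := by positivity
  set v := (B₁ * B₂ * B₃) ^ (1 / 3 : ℝ) with hv
  set d := (TernaryForm.minorGcd Q : ℝ) ^ (1 / 2 : ℝ) with hd
  set δ := |(TernaryForm.discr Q : ℝ)| ^ (1 / 3 : ℝ) with hδ
  have hv0 : 0 < v := Real.rpow_pos_of_pos hV _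
  have hd0 : 0 < d := Real.rpow_pos_of_pos hD _
  have hδ0 : 0 < δ := Real.rpow_pos_of_pos hΔ0 _
  have ev : v ^ 3 = B₁ * B₂ * B₃ := by
    rw [hv, ← Real.rpow_natCast, ← Real.rpow_mul hV.le]; norm_num
  have ed : d ^ 2 = TernaryForm.minorGcd Q := by
    rw [hd, ← Real.rpow_natCast, ← Real.rpow_mul hD.le]; norm_num
  have eδ : δ ^ 3 = |(TernaryForm.discr Q : ℝ)| := by
    rw [hδ, ← Real.rpow_natCast, ← Real.rpow_mul hΔ0.le]; norm_num
  -- The value giving equality in the hypothesis on `r`: `r³ B₁B₂B₃ = |Δ| / (2 ^ 21 D^(3/2))`, the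
  -- cube root of `2 ^ 21` being `2 ^ 7`.
  set r := δ / (2 ^ 7 * d * v) with hr
  have hr0 : 0 < r := by positivity
  have hcard := TernaryForm.ncard_primitiveZeros_le hQ hΔ hiso hχ w (B := ![B₁, B₂, B₃])
    (fun i => by fin_cases i <;> simpa) hr0 (le_of_eq (by
      simp only [Matrix.cons_val_zero, Matrix.cons_val_one, Matrix.cons_val]
      rw [← sq_abs (TernaryForm.discr Q : ℝ), ← eδ, ← ev, ← ed, hr]
      field_simp))
  have hC : (0 : ℝ) ≤ TernaryForm.constC Q χ w := by
    exact_mod_cast TernaryForm.constC_nonneg hQ hΔ hχ w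
  have hfin : ((TernaryForm.primitiveZeros Q ![B₁, B₂, B₃]).ncard : ℝ)
      ≤ 8 * (TernaryForm.constC Q χ w : ℝ) * (416 + 624 * (2 ^ 7 * (v * d / δ))) := by
    refine le_of_mul_le_mul_right (hcard.trans (le_of_eq ?_)) hr0
    rw [hr]
    field_simp
  refine hfin.trans ?_
  have : 0 ≤ v * d / δ := by positivity
  nlinarith [mul_nonneg hC this]
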